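/- Write permutations $\sigma\in S_n$ in vector notation $\sigma=[\sigma(1),\dots,\sigma(n)]$. For $1<j\le n$ the push-to-the-top transition $t_{\uparrow j}:S_n\to S_n$ moves the $j$-th entry to the first place: $$t_{\uparrow j}([a_1,\dots,a_n])=[a_j,a_1,\dots,a_{j-1},a_{j+1},\dots,a_n].$$ The Kendall $\tau$-distance $d_{\mathcal K}(\sigma,\tau)$ is the minimal number of adjacent transpositions required to transform one vector into the other, that is, the minimal $r$ such that $\sigma=\tau\circ(i_1,i_1+1)\circ\cdots\circ(i_r,i_r+1)$ for some $i_1,\dots,i_r\in\{1,\dots,n-1\}$. An $(n,M,\mathcal K)$-snake is a sequence $c_1,\dots,c_M$ of $M$ distinct elements of $S_n$ such that, cyclically, each $c_{r+1}$ (with $c_{M+1}=c_1$) equals $t_{\uparrow j}(c_r)$ for some $1<j\le n$, and such that $d_{\mathcal K}(c_r,c_s)\ge 2$ for all $r\ne s$ (so that a single error is detected). **Theorem.** For every $m\ge 2$ there exists a $(2m+2,\check M_{2m+2},\mathcal K)$-snake, where $$\check M_{2m+2}=\frac{2m}{2m+2}\cdot\frac{(2m+2)!}{2}-(2m-2)\,2m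 .$$ In particular $\check M_{2m+2}/|S_{2m+2}|\to\frac12$ as $m\to\infty$, and this is asymptotically optimal: for all $n$ and $M$, every $(n,M,\mathcal K)$-snake satisfies $M/|S_n|\le\frac12$. -/

import Mathlib

open Filter Topology

namespace RankModulation

/-- The push-to-the-top transition `t_{↑j}` on permutations in vector notation,
`[a₁, …, a_{j-1}, a_j, a_{j+1}, …, a_n] ↦ [a_j, a₁, …, a_{j-1}, a_{j+1}, …, a_n]`, i.e.
`σ ↦ σ ∘ (j, j-1, …, 1)`. The set `[n]` is modelled by `Fin n`, so the top index is `0`;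
`j.cycleRange` is the cycle `0 ↦ 1 ↦ ⋯ ↦ j ↦ 0`. -/
def pushToTop {n : ℕ} (j : Fin n) (σ : Equiv.Perm (Fin n)) : Equiv.Perm (Fin n) :=
  σ * (Fin.cycleRange j)⁻¹

/-- The entry at index `j` is moved to the top. -/
theorem pushToTop_zero {n : ℕ} (j : Fin (n + 1)) (σ : Equiv.Perm (Fin (n + 1))) :
    pushToTop j σ 0 = σ j := by
  have h : (Fin.cycleRange j)⁻¹ 0 = j := by
    rw [Equiv.Perm.inv_eq_iff_eq, Fin.cycleRange_self]
  simp [pushToTop, Equiv.Perm.mul_apply, h]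

/-- The entries above index `j` are moved down by one place. -/
theorem pushToTop_of_lt {n : ℕ} (j k l : Fin (n + 1)) (σ : Equiv.Perm (Fin (n + 1)))
    (hkj : k < j) (hl : (l : ℕ) = k + 1) : pushToTop j σ l = σ k := by
  have h : (Fin.cycleRange j)⁻¹ l = k := by
    rw [Equiv.Perm.inv_eq_iff_eq]
    apply Fin.ext
    rw [Fin.coe_cycleRange_of_lt hkj, hl]
  simp [pushToTop, Equiv.Perm.mul_apply, h]

/-- The entries below index `j` stay in place. -/
theorem pushToTop_of_gt {n : ℕ} (j k : Fin (n + 1)) (σ : Equiv.Perm (Fin (n + 1)))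
    (hjk : j < k) : pushToTop j σ k = σ k := by
  have h : (Fin.cycleRange j)⁻¹ k = k := by
    rw [Equiv.Perm.inv_eq_iff_eq, Fin.cycleRange_of_gt hjk]
  simp [pushToTop, Equiv.Perm.mul_apply, h]

/-- `c = (c₁, …, c_M)` is a `G_↑(n, M)` code: a cyclic Gray code over `S_n`, of size `M`, whose
transitions are the push-to-the-top transitions `t_{↑j}` with `1 < j ≤ n`. Here `finRotate M r`
is the cyclic successor of the index `r`. -/
def IsPushToTopGrayCode (n M : ℕ) (c : Fin M → Equiv.Perm (Fin n)) : Prop :=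
  Function.Injective c ∧
    ∀ r : Fin M, ∃ j : Fin n, 0 < (j : ℕ) ∧ c (finRotate M r) = pushToTop j (c r)

/-- `s` is an adjacent transposition `(i, i+1)`. -/
def IsAdjTransposition {n : ℕ} (s : Equiv.Perm (Fin n)) : Prop :=
  ∃ i j : Fin n, (i : ℕ) + 1 = j ∧ s = Equiv.swap i j

/-- The Kendall τ-distance: the minimal `r` such that
`σ = τ ∘ (i₁, i₁+1) ∘ (i₂, i₂+1) ∘ ⋯ ∘ (i_r, i_r+1)` for some `i₁, …, i_r`. -/
noncomputable def kendallTau {n : ℕ} (σ τ : Equiv.Perm (Fin n)) : ℕ :=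
  sInf {r : ℕ | ∃ l : List (Equiv.Perm (Fin n)),
    l.length = r ∧ (∀ s ∈ l, IsAdjTransposition s) ∧ σ = τ * l.prod}

/-- The minimum defining the Kendall τ-distance is attained. -/
theorem kendallTau_spec {n : ℕ} (σ τ : Equiv.Perm (Fin n)) :
    ∃ l : List (Equiv.Perm (Fin n)), l.length = kendallTau σ τ ∧
      (∀ s ∈ l, IsAdjTransposition s) ∧ σ = τ * l.prod := by
  refine Nat.sInf_mem (s := {r : ℕ | ∃ l : List (Equiv.Perm (Fin n)),
    l.length = r ∧ (∀ s ∈ l, IsAdjTransposition s) ∧ σ = τ * l.prod}) ?_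
  have key : ∃ l : List (Equiv.Perm (Fin n)),
      (∀ s ∈ l, IsAdjTransposition s) ∧ l.prod = τ⁻¹ * σ := by
    cases n with
    | zero => exact ⟨[], by simp, Subsingleton.elim _ _⟩
    | succ n =>
      have h : τ⁻¹ * σ ∈ Submonoid.closure
          (Set.range fun i : Fin n => Equiv.swap i.castSucc i.succ) := by
        rw [Equiv.Perm.mclosure_swap_castSucc_succ]; trivial
      obtain ⟨l, hl, hp⟩ := Submonoid.exists_list_of_mem_closure h
      refine ⟨l, fun s hs => ?_, hp⟩
      obtain ⟨i, rfl⟩ := hl s hs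
      exact ⟨i.castSucc, i.succ, by simp, rfl⟩
  obtain ⟨l, hl, hp⟩ := key
  exact ⟨l.length, l, rfl, hl, by rw [hp]; group⟩

/-- `c` is an `(n, M, 𝒦)`-snake: a `G_↑(n, M)` code that detects a single Kendall τ-error, i.e.
any two distinct codewords are at Kendall τ-distance at least `2`. -/
def IsKendallSnake (n M : ℕ) (c : Fin M → Equiv.Perm (Fin n)) : Prop :=
  IsPushToTopGrayCode n M c ∧
    ∀ σ ∈ Set.range c, ∀ τ ∈ Set.range c, σ ≠ τ → 2 ≤ kendallTau σ τ

end RankModulation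

/-! Put `l = 2m - 2`, so `n = l + 4`. Write `a`, `b`, `f` for right multiplication by `shortCycle`,
`longCycle`, `fullCycle`, the pushes from indices `l`, `l + 2`, `l + 3`. Since `l` is even, `a` and
`b` preserve parity and fix the last position, while `f` changes parity. Two permutations of equal
parity are never at distance 1, so a code that stays even is safe; the difficulty is to change the
last entry, which needs some odd permutations.

Inside the group `H` of even permutations fixing the last index, the `a`-cycles are the cosets of
the powers of `a`. The first `l + 1` entries determine an element of `H`, because parity fixes the
order of the other two movable ones; hence `a`-cycles correspond to cyclic arrangements of `l + 1`
out of `l + 3` symbols. The element `c = a * b⁻¹` is a 3-cycle, and if `g`, `g * c`, `g * c²` lie on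
three different cycles, replacing their `a`-steps by `b`-steps merges the three cycles into one. On
arrangements this is an edge joining three that differ in one place. So it suffices to span the
arrangements by a 3-uniform hypertree. Each join adds two components, so a hypertree has an odd
number of vertices, whereas the number of cyclic arrangements is even: one must be left out, and
`exists_hyperTree_cyclicArrangements` leaves out exactly one.

`exists_path` cuts the resulting cycle into a path in `H` missing `l + 1` elements. Two `f`-steps,
passing through one odd permutation, lead from the end of a translate of the path to the start of
the next translate. Since `blockShift` satisfies `blockShift ^ (l + 2) = 1`, `l + 2` translates
close up. The missed coset is positioned so that it contains the only even permutation that could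
sit next to an odd codeword; all other candidates have a last entry that no block uses.

Optimality: `x` and `x ∘ (1, 2)` cannot both be codewords. -/

namespace RankModulation

/-! ### 3-uniform hypertrees -/

/-- The vertex sets of hypertrees in the `3`-uniform hypergraph with edges `E`: a single vertex is a
hypertree, and three disjoint hypertrees can be joined along an edge. -/
inductive HyperTree {V : Type*} (ok : V → Prop) (E : V → V → V → Prop) : Set V → Prop
  | single (v : V) : ok v → HyperTree ok E {v}
  | join {S T U : Set V} {p q r : V} : HyperTree ok E S → HyperTree ok E T → HyperTree ok E U →
      Disjoint S T → Disjoint S U → Disjoint T U → p ∈ S → q ∈ T → r ∈ U → E p q r →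
      HyperTree ok E (S ∪ (T ∪ U))

namespace HyperTree

variable {V W : Type*} {ok : V → Prop} {E : V → V → V → Prop}

theorem ok_of_mem {S : Set V} (h : HyperTree ok E S) : ∀ v ∈ S, ok v := by
  induction h with
  | single v hv => rintro w rfl; exact hv
  | join _ _ _ _ _ _ _ _ _ _ ihS ihT ihU =>
    rintro v (h | h | h)
    exacts [ihS v h, ihT v h, ihU v h]

/-- Injectivity on admissible vertices keeps the three parts of a join disjoint. -/
theorem map {ok' : W → Prop} {E' : W → W → W → Prop} (f : V → W)
    (hinj : ∀ v w, ok v → ok w → f v = f w → v = w) (hok : ∀ v, ok v → ok' (f v))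
    (hE : ∀ p q r, ok p → ok q → ok r → E p q r → E' (f p) (f q) (f r)) {S : Set V}
    (h : HyperTree ok E S) : HyperTree ok' E' (f '' S) := by
  have disj : ∀ {S T : Set V}, (∀ v ∈ S, ok v) → (∀ v ∈ T, ok v) → Disjoint S T →
      Disjoint (f '' S) (f '' T) := by
    intro S T hS hT hd
    rw [Set.disjoint_left]
    rintro _ ⟨v, hv, rfl⟩ ⟨w, hw, hvw⟩
    have := hinj w v (hT w hw) (hS v hv) hvw
    subst this
    exact Set.disjoint_left.1 hd hv hw
  induction h with
  | single v hv => rw [Set.image_singleton]; exact single _ (hok v hv)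
  | join hS hT hU dST dSU dTU hp hq hr he ihS ihT ihU =>
    rw [Set.image_union, Set.image_union]
    exact join ihS ihT ihU (disj hS.ok_of_mem hT.ok_of_mem dST)
      (disj hS.ok_of_mem hU.ok_of_mem dSU) (disj hT.ok_of_mem hU.ok_of_mem dTU)
      (Set.mem_image_of_mem f hp) (Set.mem_image_of_mem f hq) (Set.mem_image_of_mem f hr)
      (hE _ _ _ (hS.ok_of_mem _ hp) (hT.ok_of_mem _ hq) (hU.ok_of_mem _ hr) he)

theorem insert_pair {S : Set V} {p q r : V} (h : HyperTree ok E S) (hp : p ∈ S) (hq : q ∉ S)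
    (hr : r ∉ S) (hqr : q ≠ r) (okq : ok q) (okr : ok r) (he : E p q r) :
    HyperTree ok E (S ∪ ({q} ∪ {r})) :=
  join h (single q okq) (single r okr) (by simpa using hq) (by simpa using hr) (by simpa using hqr)
    hp rfl rfl he

/-- A family of disjoint pairs of hypertrees, each of which has an edge to the hypertree `S`, can be
attached to `S`. -/
theorem attach {I : Type*} {S : Set V} (h : HyperTree ok E S) (J : Finset I) (Q R : I → Set V)
    (hQ : ∀ i ∈ J, HyperTree ok E (Q i)) (hR : ∀ i ∈ J, HyperTree ok E (R i))
    (hQR : ∀ i ∈ J, Disjoint (Q i) (R i)) (hSQ : ∀ i ∈ J, Disjoint S (Q i))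
    (hSR : ∀ i ∈ J, Disjoint S (R i))
    (hd : ∀ i ∈ J, ∀ j ∈ J, i ≠ j → Disjoint (Q i ∪ R i) (Q j ∪ R j))
    (he : ∀ i ∈ J, ∃ p ∈ S, ∃ q ∈ Q i, ∃ r ∈ R i, E p q r) :
    HyperTree ok E (S ∪ ⋃ i ∈ J, (Q i ∪ R i)) := by
  classical
  induction J using Finset.induction_on with
  | empty => simpa using h
  | insert i J hi ih =>
    have ih' := ih (fun j hj => hQ j (by simp [hj])) (fun j hj => hR j (by simp [hj]))
      (fun j hj => hQR j (by simp [hj])) (fun j hj => hSQ j (by simp [hj]))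
      (fun j hj => hSR j (by simp [hj]))
      (fun j hj j' hj' => hd j (by simp [hj]) j' (by simp [hj']))
      (fun j hj => he j (by simp [hj]))
    obtain ⟨p, hp, q, hq, r, hr, e⟩ := he i (by simp)
    have hdi : ∀ j ∈ J, Disjoint (Q j ∪ R j) (Q i ∪ R i) := fun j hj =>
      hd j (by simp [hj]) i (by simp) (by rintro rfl; exact hi hj)
    have := join ih' (hQ i (by simp)) (hR i (by simp))
      (by
        rw [Set.disjoint_union_left]
        refine ⟨hSQ i (by simp), ?_⟩
        simp only [Set.disjoint_iUnion_left]
        exact fun j hj => (hdi j hj).mono_right Set.subset_union_left)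
      (by
        rw [Set.disjoint_union_left]
        refine ⟨hSR i (by simp), ?_⟩
        simp only [Set.disjoint_iUnion_left]
        exact fun j hj => (hdi j hj).mono_right Set.subset_union_right)
      (hQR i (by simp)) (Set.mem_union_left _ hp) hq hr e
    rw [Finset.set_biUnion_insert]
    rw [show S ∪ (Q i ∪ R i ∪ ⋃ x ∈ J, (Q x ∪ R x)) =
      S ∪ (⋃ x ∈ J, (Q x ∪ R x)) ∪ (Q i ∪ R i) by
        rw [Set.union_comm (Q i ∪ R i), Set.union_assoc]]
    exact this

end HyperTree

/-! ### Linear arrangements and their hypertrees -/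

section Lists

variable {α : Type*}

/-- `s` is an arrangement of `l` distinct elements of `F`. -/
def IsArrangement (F : Finset α) (l : ℕ) (s : List α) : Prop :=
  s.Nodup ∧ (∀ x ∈ s, x ∈ F) ∧ s.length = l

/-- Three arrangements which differ in one place only. -/
def ArrangementEdge (F : Finset α) (p q r : List α) : Prop :=
  ∃ u v x y z, p = u ++ x :: v ∧ q = u ++ y :: v ∧ r = u ++ z :: v ∧
    (x :: y :: z :: (u ++ v)).Nodup ∧ ∀ t ∈ x :: y :: z :: (u ++ v), t ∈ F

theorem isArrangement_cons [DecidableEq α] {F : Finset α} {l : ℕ} {x : α} {s : List α} :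
    IsArrangement F (l + 1) (x :: s) ↔ x ∈ F ∧ IsArrangement (F.erase x) l s := by
  simp only [IsArrangement, List.nodup_cons, List.mem_cons, List.length_cons, Finset.mem_erase]
  constructor
  · rintro ⟨⟨h1, h2⟩, h3, h4⟩
    refine ⟨h3 x (.inl rfl), h2, fun y hy => ⟨?_, h3 y (.inr hy)⟩, by omega⟩
    rintro rfl; exact h1 hy
  · rintro ⟨h1, h2, h3, h4⟩
    refine ⟨⟨fun h => (h3 x h).1 rfl, h2⟩, ?_, by omega⟩
    rintro y (rfl | hy)
    exacts [h1, (h3 y hy).2]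

theorem IsArrangement.eq_two {F : Finset α} {s : List α} (h : IsArrangement F 2 s) :
    ∃ x y, s = [x, y] := List.length_eq_two.1 h.2.2

theorem finite_isArrangement [DecidableEq α] (F : Finset α) (l : ℕ) :
    {s | IsArrangement F l s}.Finite := by
  induction l generalizing F with
  | zero =>
    refine (Set.finite_singleton []).subset ?_
    rintro s ⟨_, _, h⟩
    simpa using h
  | succ l ih =>
    refine (F.finite_toSet.biUnion (t := fun x => (List.cons x) '' {s | IsArrangement (F.erase x) l s})
      fun x _ => (ih _).image _).subset ?_
    rintro s hs
    match s, hs with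
    | [], hs => simp [IsArrangement] at hs
    | x :: s, hs =>
      rw [Set.mem_ofPred_eq, isArrangement_cons] at hs
      simp only [Set.mem_iUnion]
      exact ⟨x, hs.1, s, hs.2, rfl⟩

/-- An enumeration of at least two elements differs from its reverse, so one of the two avoids `t`.
This is the freedom used to stay away from an omitted vertex. -/
theorem exists_isArrangement_ne (D : Finset α) (h : 2 ≤ D.card) (t : List α) :
    ∃ s, IsArrangement D D.card s ∧ s ≠ t := by
  by_cases ht : D.toList = t
  · refine ⟨D.toList.reverse, ⟨by simpa using D.nodup_toList, by simp, by simp⟩, ?_⟩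
    rw [← ht]
    intro hrev
    have hlen : D.toList.length = D.card := D.length_toList
    have hn := D.nodup_toList
    generalize D.toList = L at *
    match L, hlen, hn, hrev with
    | [], hl, _, _ => simp at hl; omega
    | [a], hl, _, _ => simp at hl; omega
    | a :: b :: L, hl, hn, hrev =>
      have h1 : (a :: b :: L).reverse = (b :: L).reverse ++ [a] := by simp
      rw [h1] at hrev
      have := congrArg (fun l => l.head?) hrev
      rw [List.nodup_cons] at hn
      apply hn.1
      have hh : ((b :: L).reverse ++ [a]).head? = (b :: L).reverse.head? := by
        rw [List.head?_append_of_ne_nil _ (by simp)]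
      simp only [hh, List.head?_cons] at this
      exact List.mem_reverse.1 (List.mem_of_head? this)
  · exact ⟨D.toList, ⟨D.nodup_toList, by simp, by simp⟩, ht⟩

theorem IsArrangement.mem_iff {D : Finset α} {s : List α} (h : IsArrangement D D.card s) {x : α} :
    x ∈ s ↔ x ∈ D := by
  classical
  refine ⟨h.2.1 x, fun hx => ?_⟩
  have h1 : s.toFinset = D := by
    apply Finset.eq_of_subset_of_card_le
    · intro y hy; exact h.2.1 y (by simpa using hy)
    · rw [List.toFinset_card_of_nodup h.1, h.2.2]
  rw [← h1] at hx
  simpa using hx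

/-- Prepending a new element maps hypertrees of arrangements to hypertrees of arrangements. -/
theorem HyperTree.cons [DecidableEq α] {F : Finset α} {l : ℕ} {x : α} (hx : x ∈ F)
    {S : Set (List α)}
    (h : HyperTree (IsArrangement (F.erase x) l) (ArrangementEdge (F.erase x)) S) :
    HyperTree (IsArrangement F (l + 1)) (ArrangementEdge F) (List.cons x '' S) := by
  refine h.map _ (fun v w _ _ hvw => (List.cons.inj hvw).2)
    (fun v hv => isArrangement_cons.2 ⟨hx, hv⟩) ?_
  rintro p q r - - - ⟨u, v, y, z, t, rfl, rfl, rfl, hn, hm⟩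
  refine ⟨x :: u, v, y, z, t, rfl, rfl, rfl, ?_, ?_⟩
  · have hp : (y :: z :: t :: (x :: u ++ v)).Perm (x :: y :: z :: t :: (u ++ v)) :=
      List.perm_middle (l₁ := [y, z, t])
    rw [hp.nodup_iff, List.nodup_cons]
    exact ⟨fun h => (Finset.mem_erase.1 (hm x h)).1 rfl, hn⟩
  · intro s hs
    by_cases hsx : s = x
    · exact hsx ▸ hx
    · refine Finset.mem_of_mem_erase (hm s ?_)
      simp only [List.cons_append, List.mem_cons] at hs ⊢
      tauto

/-- There are 12 arrangements; without `w = [c, d]` there remain 11 = 1 + 2 · 5, reached from `[a,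
b]` by five edges. An edge fixes one of the two places and lets three symbols run through the other.
-/
theorem hyperTree_arrangements_two [DecidableEq α] {F : Finset α} (hF : F.card = 4) {w : List α}
    (hw : IsArrangement F 2 w) :
    HyperTree (IsArrangement F 2) (ArrangementEdge F) {s | IsArrangement F 2 s ∧ s ≠ w} := by
  obtain ⟨c, d, rfl⟩ := hw.eq_two
  have hc : c ∈ F := hw.2.1 c (by simp)
  have hd : d ∈ F := hw.2.1 d (by simp)
  have hcd : c ≠ d := by simpa using hw.1
  obtain ⟨a, b, hab, hFe⟩ : ∃ a b, a ≠ b ∧ (F.erase c).erase d = {a, b} := by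
    rw [← Finset.card_eq_two, Finset.card_erase_of_mem (by simp [hd, hcd.symm]),
      Finset.card_erase_of_mem hc, hF]
  have hmem : ∀ x, x ∈ F ↔ x = a ∨ x = b ∨ x = c ∨ x = d := by
    intro x
    have := Finset.ext_iff.1 hFe x
    simp only [Finset.mem_erase, Finset.mem_insert, Finset.mem_singleton] at this
    by_cases h1 : x = c
    · subst h1; simp [hc]
    by_cases h2 : x = d
    · subst h2; simp [hd]
    simpa [h1, h2] using this
  have ha : a ≠ c ∧ a ≠ d := by
    have := Finset.ext_iff.1 hFe a
    simp only [Finset.mem_erase, Finset.mem_insert, Finset.mem_singleton, true_or, iff_true] at this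
    exact ⟨this.2.1, this.1⟩
  have hb : b ≠ c ∧ b ≠ d := by
    have := Finset.ext_iff.1 hFe b
    simp only [Finset.mem_erase, Finset.mem_insert, Finset.mem_singleton, or_true, iff_true] at this
    exact ⟨this.2.1, this.1⟩
  obtain ⟨hac, had⟩ := ha
  obtain ⟨hbc, hbd⟩ := hb
  have ok : ∀ {x y}, x ∈ F → y ∈ F → x ≠ y → IsArrangement F 2 [x, y] := by
    intro x y hx hy hxy
    exact ⟨by simpa using hxy, by simp [hx, hy], rfl⟩
  have row : ∀ {t x y z}, t ∈ F → x ∈ F → y ∈ F → z ∈ F → [x, y, z, t].Nodup →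
      ArrangementEdge F [t, x] [t, y] [t, z] := by
    intro t x y z ht hx hy hz hn
    exact ⟨[t], [], x, y, z, rfl, rfl, rfl, by simpa using hn, by simp [hx, hy, hz, ht]⟩
  have col : ∀ {t x y z}, t ∈ F → x ∈ F → y ∈ F → z ∈ F → [x, y, z, t].Nodup →
      ArrangementEdge F [x, t] [y, t] [z, t] := by
    intro t x y z ht hx hy hz hn
    exact ⟨[], [t], x, y, z, rfl, rfl, rfl, by simpa using hn, by simp [hx, hy, hz, ht]⟩
  have ma : a ∈ F := by simp [hmem]
  have mb : b ∈ F := by simp [hmem]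
  have h0 : HyperTree (IsArrangement F 2) (ArrangementEdge F) {[a, b]} :=
    .single _ (ok ma mb hab)
  have h1 := h0.insert_pair (p := [a, b]) (q := [a, c]) (r := [a, d]) (by simp)
    (by simp; grind) (by simp; grind) (by simp; grind) (ok ma hc hac) (ok ma hd had)
    (row ma mb hc hd (by simp; grind))
  have h2 := h1.insert_pair (p := [a, b]) (q := [c, b]) (r := [d, b]) (by simp)
    (by simp; grind) (by simp; grind) (by simp; grind) (ok hc mb hbc.symm) (ok hd mb hbd.symm)
    (col mb ma hc hd (by simp; grind))
  have h3 := h2.insert_pair (p := [a, c]) (q := [b, c]) (r := [d, c]) (by simp)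
    (by simp; grind) (by simp; grind) (by simp; grind) (ok mb hc hbc) (ok hd hc hcd.symm)
    (col hc ma mb hd (by simp; grind))
  have h4 := h3.insert_pair (p := [b, c]) (q := [b, a]) (r := [b, d]) (by simp)
    (by simp; grind) (by simp; grind) (by simp; grind) (ok mb ma hab.symm) (ok mb hd hbd)
    (row mb hc ma hd (by simp; grind))
  have h5 := h4.insert_pair (p := [b, a]) (q := [c, a]) (r := [d, a]) (by simp)
    (by simp; grind) (by simp; grind) (by simp; grind) (ok hc ma hac.symm) (ok hd ma had.symm)
    (col ma mb hc hd (by simp; grind))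
  convert h5 using 1
  ext s
  constructor
  · rintro ⟨hs, hsw⟩
    obtain ⟨x, y, rfl⟩ := hs.eq_two
    have hx := (hmem x).1 (hs.2.1 x (by simp))
    have hy := (hmem y).1 (hs.2.1 y (by simp))
    have hxy : x ≠ y := by simpa using hs.1
    rcases hx with rfl | rfl | rfl | rfl <;> rcases hy with rfl | rfl | rfl | rfl <;>
      first
        | exact absurd rfl hxy
        | exact absurd rfl hsw
        | simp
  · intro hs
    refine ⟨h5.ok_of_mem s hs, ?_⟩
    rintro rfl
    simp at hs
    grind

end Lists

section Lists

variable {α : Type*}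

/-- A single cycle through all of `F` has length at least 3, so no point of `F` is fixed by it or by
its square. -/
theorem exists_perm_without_short_cycles (F : Finset α) (h : 3 ≤ F.card) :
    ∃ σ : Equiv.Perm α, ∀ x ∈ F, σ x ∈ F ∧ σ x ≠ x ∧ σ (σ x) ≠ x := by
  classical
  obtain ⟨σ, hσ, -⟩ := F.countable_toSet.exists_cycleOn
  refine ⟨σ, fun x hx => ⟨by simpa using hσ.1.mapsTo hx, fun h1 => ?_, fun h2 => ?_⟩⟩
  · have := (hσ.pow_apply_eq hx (n := 1)).1 (by simpa using h1)
    have := Nat.le_of_dvd (by norm_num) this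
    omega
  · have := (hσ.pow_apply_eq hx (n := 2)).1 (by simpa [pow_two] using h2)
    have := Nat.le_of_dvd (by norm_num) this
    omega

/-- For `l ≥ 2`, all arrangements of `l` out of `l + 2` elements but one form a hypertree. -/
theorem hyperTree_arrangements [DecidableEq α] {l : ℕ} (hl : 2 ≤ l) :
    ∀ (F : Finset α), F.card = l + 2 → ∀ w, IsArrangement F l w →
      HyperTree (IsArrangement F l) (ArrangementEdge F) {s | IsArrangement F l s ∧ s ≠ w} := by
  induction l, hl using Nat.le_induction with
  | base => exact fun F hF w hw => hyperTree_arrangements_two hF hw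
  | succ l hl ih =>
    intro F hF w hw
    obtain ⟨e, s₁, rfl⟩ : ∃ e s₁, w = e :: s₁ := by
      match w, hw with
      | [], hw => simp [IsArrangement] at hw
      | e :: s₁, _ => exact ⟨e, s₁, rfl⟩
    rw [isArrangement_cons] at hw
    obtain ⟨he, hs₁⟩ := hw
    have hG : (F.erase e).card = l + 2 := by rw [Finset.card_erase_of_mem he, hF]; rfl
    -- Sort the arrangements by first symbol. Each class is a hypertree up to one omitted vertex,
    -- which can be prescribed. For the class of `x ≠ e` it will be `x :: t (σ.symm x)`, and the
    -- edge through `e :: t x`, `x :: t x`, `σ x :: t x` attaches the class of `x` together with the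
    -- vertex omitted from the class of `σ x`.
    obtain ⟨σ, hσ⟩ := exists_perm_without_short_cycles (F.erase e) (by omega)
    have hD : ∀ x ∈ F.erase e, (((F.erase e).erase x).erase (σ x)).card = l := by
      intro x hx
      obtain ⟨h1, h2, -⟩ := hσ x hx
      rw [Finset.card_erase_of_mem (by rw [Finset.mem_erase]; exact ⟨h2, h1⟩),
        Finset.card_erase_of_mem hx, hG]
      rfl
    -- `t x` uses every symbol except `e`, `x`, `σ x`, so it fits behind each of these three; `t x ≠
    -- s₁` ensures that `e :: t x` belongs to the central hypertree.
    have ht : ∀ x, ∃ s, x ∈ F.erase e →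
        IsArrangement (((F.erase e).erase x).erase (σ x)) l s ∧
          (∀ y, y ∈ s ↔ y ∈ ((F.erase e).erase x).erase (σ x)) ∧ s ≠ s₁ := by
      intro x
      by_cases hx : x ∈ F.erase e
      · obtain ⟨s, hs, hne⟩ := exists_isArrangement_ne _ (by rw [hD x hx]; exact hl) s₁
        exact ⟨s, fun _ => ⟨by rwa [hD x hx] at hs, fun y => hs.mem_iff, hne⟩⟩
      · exact ⟨[], fun h => absurd h hx⟩
    choose t ht using ht
    have htmem : ∀ x ∈ F.erase e, ∀ y, y ∈ t x ↔ y ≠ σ x ∧ y ≠ x ∧ y ≠ e ∧ y ∈ F := by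
      intro x hx y
      rw [(ht x hx).2.1 y]
      simp only [Finset.mem_erase]
    have hτF : ∀ x ∈ F.erase e, σ.symm x ∈ F.erase e := by
      intro x hx
      have hmap : (F.erase e).map σ.toEmbedding = F.erase e := by
        apply Finset.eq_of_subset_of_card_le
        · intro y hy
          obtain ⟨z, hz, rfl⟩ := Finset.mem_map.1 hy
          exact (hσ z hz).1
        · rw [Finset.card_map]
      rw [← hmap] at hx
      obtain ⟨z, hz, rfl⟩ := Finset.mem_map.1 hx
      simpa using hz
    -- the arrangement `t x` is available below each of `e`, `x` and `σ x`
    have htok : ∀ x ∈ F.erase e, ∀ y ∈ F, y = e ∨ y = x ∨ y = σ x →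
        IsArrangement (F.erase y) l (t x) := by
      intro x hx y _ hyx
      refine ⟨(ht x hx).1.1, fun z hz => ?_, (ht x hx).1.2.2⟩
      rw [htmem x hx] at hz
      rw [Finset.mem_erase]
      refine ⟨?_, hz.2.2.2⟩
      rintro rfl
      rcases hyx with h | h | h
      exacts [hz.2.2.1 h, hz.2.1 h, hz.1 h]
    have hcard : ∀ x ∈ F, (F.erase x).card = l + 2 := fun x hx => by
      rw [Finset.card_erase_of_mem hx, hF]; rfl
    have key := (HyperTree.cons he (ih _ hG s₁ hs₁)).attach (F.erase e)
      (fun x => List.cons x '' {s | IsArrangement (F.erase x) l s ∧ s ≠ t (σ.symm x)})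
      (fun x => {σ x :: t x})
      (fun x hx => by
        have hxF := Finset.mem_of_mem_erase hx
        exact HyperTree.cons hxF (ih _ (hcard x hxF) _
          (htok _ (hτF x hx) x hxF (by simp))))
      (fun x hx => by
        have hxF := Finset.mem_of_mem_erase (hσ x hx).1
        exact .single _ (isArrangement_cons.2 ⟨hxF, htok x hx _ hxF (by simp)⟩))
      (fun x hx => by
        rw [Set.disjoint_singleton_right]
        rintro ⟨s, -, hs⟩
        exact (hσ x hx).2.1 (List.cons.inj hs).1.symm)
      (fun x hx => by
        rw [Set.disjoint_left]
        rintro _ ⟨s, -, rfl⟩ ⟨s', -, hs⟩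
        exact (Finset.mem_erase.1 hx).1 (List.cons.inj hs).1)
      (fun x hx => by
        rw [Set.disjoint_singleton_right]
        rintro ⟨s, -, hs⟩
        exact (Finset.mem_erase.1 (hσ x hx).1).1 (List.cons.inj hs).1.symm)
      (fun x hx y hy hxy => by
        rw [Set.disjoint_left]
        rintro _ (⟨s, hs, rfl⟩ | rfl) (⟨s', hs', h⟩ | h)
        · exact hxy (List.cons.inj h).1.symm
        · obtain ⟨h1, h2⟩ := List.cons.inj h
          apply hs.2
          rw [h1, h2, Equiv.symm_apply_apply]
        · obtain ⟨h1, h2⟩ := List.cons.inj h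
          apply hs'.2
          rw [h1, h2, Equiv.symm_apply_apply]
        · exact hxy (σ.injective (List.cons.inj h).1))
      (fun x hx => by
        have hxF := Finset.mem_of_mem_erase hx
        have hσF := Finset.mem_of_mem_erase (hσ x hx).1
        refine ⟨e :: t x, ⟨t x, ⟨htok x hx e he (by simp), (ht x hx).2.2⟩, rfl⟩, x :: t x,
          ⟨t x, ⟨htok x hx x hxF (by simp), fun h => ?_⟩, rfl⟩, _, rfl, [], t x, e, x, σ x,
          rfl, rfl, rfl, ?_, ?_⟩
        -- `x :: t x` is not the vertex omitted from its own class: `σ.symm x` occurs in `t x`,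
        -- since `σ` has no fixed points or 2-cycles here, but it does not occur in `t (σ.symm x)`.
        · have hp := hτF x hx
          have h1 : σ.symm x ∈ t x := by
            rw [htmem x hx]
            refine ⟨fun h1 => ?_, fun h1 => ?_, (Finset.mem_erase.1 hp).1, (Finset.mem_erase.1 hp).2⟩
            · apply (hσ x hx).2.2
              rw [← h1, Equiv.apply_symm_apply]
            · apply (hσ x hx).2.1
              conv_lhs => rw [← h1]
              rw [Equiv.apply_symm_apply]
          rw [h, htmem _ hp] at h1
          exact h1.2.1 rfl
        · have h1 := (Finset.mem_erase.1 hx).1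
          have h2 := (Finset.mem_erase.1 (hσ x hx).1).1
          have h3 := (hσ x hx).2.1
          simp only [List.nil_append, List.nodup_cons, List.mem_cons, htmem x hx]
          refine ⟨?_, ?_, ?_, (ht x hx).1.1⟩
          · simp [h1.symm, h2.symm]
          · simp [h3.symm]
          · simp
        · intro y hy
          simp only [List.nil_append, List.mem_cons, htmem x hx] at hy
          rcases hy with rfl | rfl | rfl | hy
          exacts [he, hxF, hσF, hy.2.2.2])
    convert key using 1
    ext s
    refine ⟨?_, fun hs => ⟨key.ok_of_mem s hs, ?_⟩⟩
    · rintro ⟨hs, hne⟩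
      match s, hs with
      | [], hs => simp [IsArrangement] at hs
      | x :: s, hs =>
        rw [isArrangement_cons] at hs
        by_cases hx : x = e
        · subst hx
          exact .inl ⟨s, ⟨hs.2, fun h => hne (h ▸ rfl)⟩, rfl⟩
        · right
          have hxe : x ∈ F.erase e := Finset.mem_erase.2 ⟨hx, hs.1⟩
          simp only [Set.mem_iUnion]
          by_cases hst : s = t (σ.symm x)
          · exact ⟨σ.symm x, hτF x hxe, .inr (by rw [hst]; simp)⟩
          · exact ⟨x, hxe, .inl ⟨s, ⟨hs.2, hst⟩, rfl⟩⟩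
    · rintro rfl
      rcases hs with ⟨s, hs, h⟩ | hs
      · exact hs.2 (List.cons.inj h).2
      · simp only [Set.mem_iUnion] at hs
        obtain ⟨x, hx, ⟨s, -, h⟩ | h⟩ := hs
        · exact (Finset.mem_erase.1 hx).1 (List.cons.inj h).1
        · exact (Finset.mem_erase.1 (hσ x hx).1).1 (List.cons.inj h).1.symm

/-! ### Cyclic arrangements and their hypertree -/

theorem exists_fixedPointFree_involution (F : Finset α) (h : Even F.card) :
    ∃ ι : α → α, ∀ x ∈ F, ι x ∈ F ∧ ι x ≠ x ∧ ι (ι x) = x := by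
  classical
  obtain ⟨r, hr⟩ := h
  have e : F ≃ Fin r ⊕ Fin r := (F.equivFinOfCardEq hr).trans finSumFinEquiv.symm
  refine ⟨fun x => if hx : x ∈ F then (e.symm (e ⟨x, hx⟩).swap : F) else x, fun x hx => ?_⟩
  simp only [hx, dif_pos, Finset.coe_mem, ne_eq]
  refine ⟨trivial, fun h => ?_, by simp⟩
  have h1 : e.symm (e ⟨x, hx⟩).swap = ⟨x, hx⟩ := Subtype.ext h
  rw [Equiv.symm_apply_eq] at h1
  rcases h2 : e ⟨x, hx⟩ with i | i <;> simp [h2] at h1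

/-- `C` is a cyclic arrangement of `k` distinct elements of `F`. -/
def IsCyclicArrangement (F : Finset α) (k : ℕ) (C : Cycle α) : Prop :=
  ∃ s : List α, C = s ∧ IsArrangement F k s

/-- Three cyclic arrangements which differ in one place only. -/
def CyclicArrangementEdge (F : Finset α) (P Q R : Cycle α) : Prop :=
  ∃ (s : List α) (x y z : α), P = (x :: s : List α) ∧ Q = (y :: s : List α) ∧
    R = (z :: s : List α) ∧ (x :: y :: z :: s).Nodup ∧ ∀ t ∈ x :: y :: z :: s, t ∈ F

/-- The symbol `o` occurs only once, so a rotation that returns it to the front is trivial. Cyclic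
arrangements containing `o` are thus the same as linear arrangements of the other symbols. -/
theorem cons_isRotated_cons {o : α} {s t : List α} (h : (o :: s).IsRotated (o :: t))
    (hn : (o :: s).Nodup) : s = t := by
  obtain ⟨n, hn', h⟩ := List.isRotated_iff_mod.1 h
  have hlen : n = 0 ∨ n < (o :: s).length ∨ n = (o :: s).length := by omega
  rcases hlen with rfl | h1 | rfl
  · simpa using h
  · have h2 : ((o :: s).rotate n)[0]'(by simp) = o := by simp [h]
    rw [List.getElem_rotate] at h2
    have h3 := (hn.getElem_inj_iff (i := (0 + n) % (o :: s).length) (j := 0)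
      (hi := Nat.mod_lt _ (by simp)) (hj := by simp)).1 (by simpa using h2)
    rw [zero_add, Nat.mod_eq_of_lt h1] at h3
    subst h3
    simpa using h
  · rw [List.rotate_length] at h
    exact (List.cons.inj h).2

theorem exists_cons_isRotated {s : List α} {x : α} (hx : x ∈ s) :
    ∃ t, s.IsRotated (x :: t) := by
  obtain ⟨u, v, rfl⟩ := List.append_of_mem hx
  exact ⟨v ++ u, List.isRotated_append⟩

theorem IsArrangement.isRotated {F : Finset α} {k : ℕ} {s t : List α} (hs : IsArrangement F k s)
    (h : s.IsRotated t) : IsArrangement F k t :=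
  ⟨h.perm.nodup_iff.1 hs.1, fun x hx => hs.2.1 x (h.perm.mem_iff.2 hx),
    h.perm.length_eq.symm.trans hs.2.2⟩

/-- For odd `k ≥ 3`, all cyclic arrangements of `k` out of `k + 2` elements but one form a
hypertree. -/
theorem exists_hyperTree_cyclicArrangements [DecidableEq α] {k : ℕ} (hk : 3 ≤ k) (hodd : Odd k)
    (F : Finset α) (hF : F.card = k + 2) :
    ∃ s, IsArrangement F k s ∧ HyperTree (IsCyclicArrangement F k) (CyclicArrangementEdge F)
      {C | IsCyclicArrangement F k C ∧ C ≠ s} := by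
  obtain ⟨l, rfl⟩ : ∃ l, k = l + 1 := ⟨k - 1, by omega⟩
  obtain ⟨o, ho⟩ : F.Nonempty := by rw [← Finset.card_pos]; omega
  have hG : (F.erase o).card = l + 2 := by rw [Finset.card_erase_of_mem ho, hF]; rfl
  -- Oddness of `k` makes the number of symbols other than `o` even. A cyclic arrangement without
  -- `o` misses exactly one of them, say `q'`; written as `ι q' :: A`, it is paired with `q' :: A`,
  -- and the edge through `o :: A` attaches both.
  obtain ⟨ι, hι⟩ := exists_fixedPointFree_involution (F.erase o) (by
    rw [hG]
    obtain ⟨r, hr⟩ := hodd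
    exact ⟨r + 1, by omega⟩)
  obtain ⟨p, hp⟩ : (F.erase o).Nonempty := by rw [← Finset.card_pos]; omega
  -- The omitted `w` will miss `p` and `q`. As `{p, q}` is not an orbit of `ι`, no edge used for
  -- attaching needs the vertex `o :: w`.
  obtain ⟨q, hq⟩ : (((F.erase o).erase p).erase (ι p)).Nonempty := by
    rw [← Finset.card_pos, Finset.card_erase_of_mem (Finset.mem_erase.2 ⟨(hι p hp).2.1, (hι p hp).1⟩),
      Finset.card_erase_of_mem hp, hG]
    omega
  rw [Finset.mem_erase, Finset.mem_erase] at hq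
  obtain ⟨hqι, hqp, hq⟩ := hq
  have hcard : (((F.erase o).erase p).erase q).card = l := by
    rw [Finset.card_erase_of_mem (Finset.mem_erase.2 ⟨hqp, hq⟩), Finset.card_erase_of_mem hp, hG]
    rfl
  obtain ⟨w, hw, -⟩ := exists_isArrangement_ne (((F.erase o).erase p).erase q)
    (by omega) []
  have hwmem := fun x => hw.mem_iff (x := x)
  rw [hcard] at hw
  simp only [Finset.mem_erase] at hwmem
  have hwG : IsArrangement (F.erase o) l w :=
    ⟨hw.1, fun x hx => by rw [hwmem] at hx; simp [hx.2.2], hw.2.2⟩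
  refine ⟨o :: w, isArrangement_cons.2 ⟨ho, hwG⟩, ?_⟩
  have hT := hyperTree_arrangements (by omega) (F.erase o) hG w hwG
  have hT' := hT.map (ok' := IsCyclicArrangement F (l + 1)) (E' := CyclicArrangementEdge F)
    (fun s => ((o :: s : List α) : Cycle α))
    (fun s t hs ht h => cons_isRotated_cons (Cycle.coe_eq_coe.1 h)
      (isArrangement_cons.2 ⟨ho, hs⟩).1)
    (fun s hs => ⟨_, rfl, isArrangement_cons.2 ⟨ho, hs⟩⟩)
    (by
      rintro _ _ _ - - - ⟨u, v, x, y, z, rfl, rfl, rfl, hn, hm⟩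
      refine ⟨v ++ o :: u, x, y, z, Cycle.coe_eq_coe.2 (List.isRotated_append (l := o :: u)),
        Cycle.coe_eq_coe.2 (List.isRotated_append (l := o :: u)),
        Cycle.coe_eq_coe.2 (List.isRotated_append (l := o :: u)), ?_, ?_⟩
      · have hp : (x :: y :: z :: (v ++ o :: u)).Perm (o :: x :: y :: z :: (u ++ v)) := by
          have h1 : (v ++ o :: u).Perm (o :: (u ++ v)) :=
            List.perm_middle.trans ((List.perm_append_comm).cons o)
          exact (((h1.cons z).cons y).cons x).trans
            (List.perm_middle (l₁ := [x, y, z]))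
        rw [hp.nodup_iff, List.nodup_cons]
        exact ⟨fun h => (Finset.mem_erase.1 (hm o h)).1 rfl, hn⟩
      · intro t ht
        by_cases hto : t = o
        · exact hto ▸ ho
        · refine Finset.mem_of_mem_erase (hm t ?_)
          simp only [List.mem_cons, List.mem_append] at ht ⊢
          tauto)
  -- the arrangements of the elements other than `o`, `x` and `ι x`
  have hfin : {A : List α | IsArrangement (F.erase o) l A ∧
      ∃ x ∈ F.erase o, x ∉ A ∧ ι x ∉ A}.Finite :=
    (finite_isArrangement (F.erase o) l).subset fun A hA => hA.1
  have hx : ∀ A : List α, ∃ x, A ∈ hfin.toFinset → x ∈ F.erase o ∧ x ∉ A ∧ ι x ∉ A := by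
    intro A
    by_cases hA : A ∈ hfin.toFinset
    · obtain ⟨x, hx⟩ := (hfin.mem_toFinset.1 hA).2
      exact ⟨x, fun _ => hx⟩
    · exact ⟨o, fun h => absurd h hA⟩
  choose x hx using hx
  have hA : ∀ A ∈ hfin.toFinset, IsArrangement (F.erase o) l A := fun A hA =>
    (hfin.mem_toFinset.1 hA).1
  have hxι : ∀ A ∈ hfin.toFinset, (x A :: ι (x A) :: A).Nodup := by
    intro A h
    obtain ⟨h1, h2, h3⟩ := hx A h
    simp [h2, h3, (hA A h).1, (hι _ h1).2.1.symm]
  have hall : ∀ A ∈ hfin.toFinset, ∀ y ∈ F.erase o, y = x A ∨ y = ι (x A) ∨ y ∈ A := by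
    intro A h y hy
    obtain ⟨h1, h2, h3⟩ := hx A h
    have harr : IsArrangement (F.erase o) (F.erase o).card (x A :: ι (x A) :: A) := by
      refine ⟨hxι A h, ?_, by rw [hG, List.length_cons, List.length_cons, (hA A h).2.2]⟩
      intro z hz
      simp only [List.mem_cons] at hz
      rcases hz with rfl | rfl | hz
      exacts [h1, (hι _ h1).1, (hA A h).2.1 z hz]
    simpa using harr.mem_iff.2 hy
  have hxA : ∀ A ∈ hfin.toFinset, ∀ y, y = x A ∨ y = ι (x A) →
      IsArrangement F (l + 1) (y :: A) ∧ o ∉ y :: A := by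
    intro A h y hy
    obtain ⟨h1, h2, h3⟩ := hx A h
    have hyo : y ∈ F.erase o := by
      rcases hy with rfl | rfl
      exacts [h1, (hι _ h1).1]
    have hyA : y ∉ A := by
      rcases hy with rfl | rfl
      exacts [h2, h3]
    refine ⟨isArrangement_cons.2 ⟨Finset.mem_of_mem_erase hyo, (hA A h).1, fun z hz => ?_,
      (hA A h).2.2⟩, ?_⟩
    · rw [Finset.mem_erase]
      exact ⟨by rintro rfl; exact hyA hz, Finset.mem_of_mem_erase ((hA A h).2.1 z hz)⟩
    · rw [List.mem_cons]
      rintro (rfl | h')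
      · exact (Finset.mem_erase.1 hyo).1 rfl
      · exact (Finset.mem_erase.1 ((hA A h).2.1 _ h')).1 rfl
  have hdo : ∀ A ∈ hfin.toFinset, ∀ y, y = x A ∨ y = ι (x A) →
      Disjoint ((fun s => ((o :: s : List α) : Cycle α)) ''
        {s | IsArrangement (F.erase o) l s ∧ s ≠ w}) {((y :: A : List α) : Cycle α)} := by
    intro A h y hy
    rw [Set.disjoint_singleton_right]
    rintro ⟨s, -, hs⟩
    exact (hxA A h y hy).2 ((Cycle.coe_eq_coe.1 hs).perm.mem_iff.1 (by simp))
  -- The pairs are disjoint: among the symbols other than `o`, the arrangement `y :: A` misses only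
  -- `ι y`. The missing symbol therefore recovers `y`, and then `A`.
  have hinj : ∀ A ∈ hfin.toFinset, ∀ B ∈ hfin.toFinset, ∀ y z, y = x A ∨ y = ι (x A) →
      z = x B ∨ z = ι (x B) → (y :: A).IsRotated (z :: B) → A = B := by
    intro A h B h' y z hy hz hrot
    have hιι : ∀ C ∈ hfin.toFinset, ∀ y, y = x C ∨ y = ι (x C) →
        y ∈ F.erase o ∧ ∀ t ∈ F.erase o, t ∉ y :: C ↔ t = ι y := by
      intro C h y hy
      obtain ⟨h1, h2, h3⟩ := hx C h
      have hn := hxι C h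
      simp only [List.nodup_cons, List.mem_cons, not_or] at hn
      rcases hy with rfl | rfl
      · refine ⟨h1, fun t ht => ⟨fun htn => ?_, ?_⟩⟩
        · rcases hall C h t ht with rfl | rfl | h4
          · simp at htn
          · rfl
          · simp [h4] at htn
        · rintro rfl
          simp [h3, (hι _ h1).2.1]
      · refine ⟨(hι _ h1).1, fun t ht => ⟨fun htn => ?_, ?_⟩⟩
        · rcases hall C h t ht with rfl | rfl | h4
          · exact (hι _ h1).2.2.symm
          · simp at htn
          · simp [h4] at htn
        · rintro rfl
          rw [(hι _ h1).2.2]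
          simp [h2, (hι _ h1).2.1.symm]
    obtain ⟨hy1, hy2⟩ := hιι A h y hy
    obtain ⟨hz1, hz2⟩ := hιι B h' z hz
    have h1 : ι y ∉ y :: A := (hy2 _ (hι y hy1).1).2 rfl
    rw [hrot.perm.mem_iff, hz2 _ (hι y hy1).1] at h1
    have h2 : y = z := by
      rw [← (hι y hy1).2.2, h1, (hι z hz1).2.2]
    subst h2
    exact cons_isRotated_cons hrot (hxA A h y hy).1.1
  have key := hT'.attach hfin.toFinset (fun A => {((x A :: A : List α) : Cycle α)})
    (fun A => {((ι (x A) :: A : List α) : Cycle α)})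
    (fun A h => .single _ ⟨_, rfl, (hxA A h _ (.inl rfl)).1⟩)
    (fun A h => .single _ ⟨_, rfl, (hxA A h _ (.inr rfl)).1⟩)
    (fun A h => by
      rw [Set.disjoint_singleton]
      intro hrot
      have h1 : x A ∈ ι (x A) :: A := (Cycle.coe_eq_coe.1 hrot).perm.mem_iff.1 (by simp)
      have h2 := hxι A h
      rw [List.nodup_cons] at h2
      exact h2.1 h1)
    (fun A h => hdo A h _ (.inl rfl))
    (fun A h => hdo A h _ (.inr rfl))
    (fun A h B h' hAB => by
      rw [Set.disjoint_left]
      rintro _ (rfl | rfl) (hC | hC)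
      · exact hAB (hinj A h B h' _ _ (.inl rfl) (.inl rfl) (Cycle.coe_eq_coe.1 hC))
      · exact hAB (hinj A h B h' _ _ (.inl rfl) (.inr rfl) (Cycle.coe_eq_coe.1 hC))
      · exact hAB (hinj A h B h' _ _ (.inr rfl) (.inl rfl) (Cycle.coe_eq_coe.1 hC))
      · exact hAB (hinj A h B h' _ _ (.inr rfl) (.inr rfl) (Cycle.coe_eq_coe.1 hC)))
    (fun A h => by
      obtain ⟨h1, h2, h3⟩ := hx A h
      refine ⟨_, ⟨A, ⟨hA A h, ?_⟩, rfl⟩, _, rfl, _, rfl, A, o, x A, ι (x A), rfl, rfl, rfl, ?_, ?_⟩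
      · rintro rfl
        have h4 : x A = p ∨ x A = q := by
          have := hwmem (x A)
          have := (Finset.mem_erase.1 h1)
          tauto
        have h5 : ι (x A) = p ∨ ι (x A) = q := by
          have := hwmem (ι (x A))
          have := (Finset.mem_erase.1 (hι _ h1).1)
          tauto
        have h6 := (hι _ h1).2
        rcases h4 with h4 | h4 <;> rw [h4] at h5 h6 <;> rcases h5 with h5 | h5
        · exact h6.1 h5
        · exact hqι h5.symm
        · rw [h5] at h6; exact hqι h6.2.symm
        · exact h6.1 h5
      · rw [List.nodup_cons]
        refine ⟨?_, hxι A h⟩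
        have h4 := (hxA A h _ (.inl rfl)).2
        have h5 := (hxA A h _ (.inr rfl)).2
        simp only [List.mem_cons] at h4 h5 ⊢
        tauto
      · intro t ht
        simp only [List.mem_cons] at ht
        rcases ht with rfl | rfl | rfl | ht
        exacts [ho, Finset.mem_of_mem_erase h1, Finset.mem_of_mem_erase (hι _ h1).1,
          Finset.mem_of_mem_erase ((hA A h).2.1 t ht)])
  convert key using 1
  ext C
  refine ⟨?_, fun hC => ⟨key.ok_of_mem C hC, ?_⟩⟩
  · rintro ⟨⟨s, rfl, hs⟩, hne⟩
    by_cases hos : o ∈ s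
    · obtain ⟨t, ht⟩ := exists_cons_isRotated hos
      left
      rw [Cycle.coe_eq_coe.2 ht] at hne ⊢
      exact ⟨t, ⟨(isArrangement_cons.1 (hs.isRotated ht)).2, fun h => hne (by rw [h])⟩, rfl⟩
    · right
      -- `q'` is the element other than `o` which does not occur
      have hsG : s.toFinset ⊆ F.erase o := by
        intro y hy
        rw [List.mem_toFinset] at hy
        exact Finset.mem_erase.2 ⟨by rintro rfl; exact hos hy, hs.2.1 y hy⟩
      have hsc : s.toFinset.card = l + 1 := by
        rw [List.toFinset_card_of_nodup hs.1, hs.2.2]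
      obtain ⟨q', hq'⟩ : ∃ q', F.erase o \ s.toFinset = {q'} := by
        rw [← Finset.card_eq_one, Finset.card_sdiff_of_subset hsG, hG, hsc]
        omega
      have hq'm : ∀ y ∈ F.erase o, y ∉ s ↔ y = q' := by
        intro y hy
        have := Finset.ext_iff.1 hq' y
        simpa only [Finset.mem_sdiff, hy, true_and, List.mem_toFinset, Finset.mem_singleton]
          using this
      have hq'G : q' ∈ F.erase o := by
        have := Finset.ext_iff.1 hq' q'
        simp only [Finset.mem_sdiff, Finset.mem_singleton, iff_true] at this
        exact this.1
      have hιq : ι q' ∈ s := by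
        by_contra h
        exact (hι _ hq'G).2.1 ((hq'm _ (hι _ hq'G).1).1 h)
      obtain ⟨A, hrot⟩ := exists_cons_isRotated hιq
      have hsA := hs.isRotated hrot
      have hn := hsA.1
      rw [List.nodup_cons] at hn
      have hoA : o ∉ A := fun h => hos (hrot.perm.mem_iff.2 (by simp [h]))
      have hq'A : q' ∉ A := fun h =>
        ((hq'm q' hq'G).2 rfl) (hrot.perm.mem_iff.2 (by simp [h]))
      have hAm : A ∈ hfin.toFinset := by
        rw [hfin.mem_toFinset]
        refine ⟨⟨hn.2, fun y hy => ?_, by simpa using hsA.2.2⟩, q', hq'G, hq'A, hn.1⟩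
        rw [Finset.mem_erase]
        exact ⟨by rintro rfl; exact hoA hy, hsA.2.1 y (by simp [hy])⟩
      simp only [Set.mem_iUnion]
      refine ⟨A, hAm, ?_⟩
      rw [Cycle.coe_eq_coe.2 hrot]
      rcases hall A hAm _ (hι _ hq'G).1 with h | h | h
      · rw [h]; exact .inl rfl
      · rw [h]; exact .inr rfl
      · exact absurd h hn.1
  · rintro rfl
    rcases hC with ⟨s, hs, h⟩ | hC
    · exact hs.2 (cons_isRotated_cons (Cycle.coe_eq_coe.1 h)
        (isArrangement_cons.2 ⟨ho, hs.1⟩).1)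
    · simp only [Set.mem_iUnion] at hC
      obtain ⟨A, hAm, h | h⟩ := hC
      · exact (hxA A hAm _ (.inl rfl)).2
          ((Cycle.coe_eq_coe.1 h).perm.mem_iff.1 (by simp))
      · exact (hxA A hAm _ (.inr rfl)).2
          ((Cycle.coe_eq_coe.1 h).perm.mem_iff.1 (by simp))

end Lists

/-! ### Merging cycles by switching generators -/

section Merging

theorem Cycle.chain_coe_of_getLast {α : Type*} {R : α → α → Prop} {L : List α}
    (h : L.IsChain R) (hlast : ∀ x ∈ L.getLast?, ∀ y ∈ L.head?, R x y) :
    Cycle.Chain R (L : Cycle α) := by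
  match L, h, hlast with
  | [], _, _ => simp
  | x :: L, h, hlast =>
    rw [Cycle.chain_coe_cons, ← List.cons_append, List.isChain_append]
    exact ⟨h, by simp, fun u hu v hv => hlast u hu v (by simpa using hv)⟩

variable {G : Type*} [Group G] {a b : G}

/-- A step `x ↦ x * a`, or a step `x ↦ x * b` at an `x` such that the three points which are
rerouted together with `x` all lie in `S`. -/
def SwitchStep (a b : G) (S : Set G) (x y : G) : Prop :=
  y = x * a ∨ (y = x * b ∧ x * (a * b⁻¹) ∈ S ∧ x * (a * b⁻¹) * (a * b⁻¹) ∈ S)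

theorem SwitchStep.mono {S T : Set G} (h : S ⊆ T) {x y : G} (hs : SwitchStep a b S x y) :
    SwitchStep a b T x y :=
  hs.imp id fun h' => ⟨h'.1, h h'.2.1, h h'.2.2⟩

/-- There is a cyclic sequence of switch steps through all points of `S`. -/
def Traversable (a b : G) (S : Set G) : Prop :=
  ∃ s : Cycle G, s.Nodup ∧ (∀ x, x ∈ s ↔ x ∈ S) ∧ s.Chain (SwitchStep a b S)

/-- A `b`-step from `g` would require `g * (a * b⁻¹)` in `S`. The step leaving `g` is therefore an
`a`-step, and the cycle can be cut there. -/
theorem Traversable.exists_list {S : Set G} (h : Traversable a b S) {g : G} (hg : g ∈ S)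
    (hgc : g * (a * b⁻¹) ∉ S) :
    ∃ L : List G, L.Nodup ∧ (∀ x, x ∈ L ↔ x ∈ S) ∧ L.IsChain (SwitchStep a b S) ∧
      L.head? = some (g * a) ∧ L.getLast? = some g := by
  obtain ⟨s, hn, hm, hc⟩ := h
  induction s using Quotient.inductionOn' with
  | _ L₀
  obtain ⟨L, hL⟩ := exists_cons_isRotated ((hm g).2 hg : g ∈ L₀)
  have hLc : (Quotient.mk'' L₀ : Cycle G) = ((g :: L : List G) : Cycle G) := Cycle.coe_eq_coe.2 hL
  rw [hLc] at hn hm hc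
  rw [Cycle.nodup_coe_iff] at hn
  rw [Cycle.chain_coe_cons, List.isChain_cons] at hc
  have hp : (L ++ [g]).Perm (g :: L) := List.perm_append_singleton g L
  refine ⟨L ++ [g], hp.nodup_iff.2 hn, fun x => ?_, hc.2, ?_, by simp⟩
  · rw [hp.mem_iff, ← hm x, Cycle.mem_coe_iff]
  · obtain ⟨y, hy⟩ : ∃ y, (L ++ [g]).head? = some y := by
      cases L <;> simp
    rw [hy]
    rcases hc.1 y hy with rfl | ⟨-, h, -⟩
    · rfl
    · exact absurd h hgc

/-- With `c = a * b⁻¹` and `c ^ 3 = 1`, one has `g * b = g * c ^ 2 * a`, and likewise for `g * c`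
and `g * c ^ 2`. Replacing the `a`-steps at these three points by `b`-steps permutes their targets
cyclically, which joins the cycles in the order `S`, `U`, `T`. -/
theorem Traversable.merge {S T U : Set G} (hS : Traversable a b S) (hT : Traversable a b T)
    (hU : Traversable a b U) (hST : Disjoint S T) (hSU : Disjoint S U) (hTU : Disjoint T U)
    (hab : (a * b⁻¹) ^ 3 = 1) {g : G} (hgS : g ∈ S) (hgT : g * (a * b⁻¹) ∈ T)
    (hgU : g * (a * b⁻¹) * (a * b⁻¹) ∈ U) : Traversable a b (S ∪ (T ∪ U)) := by
  have h3 : g * (a * b⁻¹) * (a * b⁻¹) * (a * b⁻¹) = g := by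
    rw [mul_assoc, mul_assoc, ← pow_two, ← pow_succ', hab, mul_one]
  obtain ⟨L₁, n₁, m₁, c₁, f₁, l₁⟩ := hS.exists_list hgS (Set.disjoint_right.1 hST hgT)
  obtain ⟨L₂, n₂, m₂, c₂, f₂, l₂⟩ := hT.exists_list hgT (Set.disjoint_right.1 hTU hgU)
  obtain ⟨L₃, n₃, m₃, c₃, f₃, l₃⟩ := hU.exists_list hgU
    (by rw [h3]; exact Set.disjoint_left.1 hSU hgS)
  have hSs : S ⊆ S ∪ (T ∪ U) := Set.subset_union_left
  have hTs : T ⊆ S ∪ (T ∪ U) := Set.subset_union_left.trans Set.subset_union_right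
  have hUs : U ⊆ S ∪ (T ∪ U) := Set.subset_union_right.trans Set.subset_union_right
  have e₁ : g * b = g * (a * b⁻¹) * (a * b⁻¹) * a := by
    conv_lhs => rw [← h3]
    group
  have e₂ : g * (a * b⁻¹) * b = g * a := by group
  have e₃ : g * (a * b⁻¹) * (a * b⁻¹) * b = g * (a * b⁻¹) * a := by group
  refine ⟨(L₁ ++ (L₃ ++ L₂) : List G), ?_, ?_, ?_⟩
  · rw [Cycle.nodup_coe_iff]
    refine List.nodup_append'.2 ⟨n₁, List.nodup_append'.2 ⟨n₃, n₂, ?_⟩, ?_⟩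
    · intro x h h'
      exact Set.disjoint_left.1 hTU ((m₂ x).1 h') ((m₃ x).1 h)
    · intro x h h'
      rw [List.mem_append, m₂, m₃] at h'
      rw [m₁] at h
      rcases h' with h' | h'
      exacts [Set.disjoint_left.1 hSU h h', Set.disjoint_left.1 hST h h']
  · intro x
    rw [Cycle.mem_coe_iff, List.mem_append, List.mem_append, m₁, m₂, m₃]
    simp only [Set.mem_union]
    tauto
  · apply Cycle.chain_coe_of_getLast
    · rw [List.isChain_append, List.isChain_append]
      refine ⟨c₁.imp fun _ _ h => h.mono hSs, ⟨c₃.imp fun _ _ h => h.mono hUs,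
        c₂.imp fun _ _ h => h.mono hTs, ?_⟩, ?_⟩
      · intro x hx y hy
        rw [l₃, Option.mem_some_iff] at hx
        rw [f₂, Option.mem_some_iff] at hy
        subst hx hy
        refine .inr ⟨e₃.symm, ?_, ?_⟩
        · rw [h3]; exact hSs hgS
        · rw [h3]; exact hTs hgT
      · intro x hx y hy
        rw [l₁, Option.mem_some_iff] at hx
        rw [List.head?_append, f₃, Option.some_or, Option.mem_some_iff] at hy
        subst hx hy
        exact .inr ⟨e₁.symm, hTs hgT, hUs hgU⟩
    · intro x hx y hy
      rw [List.getLast?_append, List.getLast?_append, l₂, Option.some_or, Option.some_or,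
        Option.mem_some_iff] at hx
      rw [List.head?_append, f₁, Option.some_or, Option.mem_some_iff] at hy
      subst hx hy
      refine .inr ⟨e₂.symm, hUs hgU, ?_⟩
      rw [h3]
      exact hSs hgS

theorem Traversable.of_powers [Finite G] (a b g : G) :
    Traversable a b {x | ∃ i : ℕ, x = g * a ^ i} := by
  have ho : 0 < orderOf a := orderOf_pos a
  obtain ⟨o, ho'⟩ : ∃ o, orderOf a = o + 1 := ⟨orderOf a - 1, by omega⟩
  refine ⟨((List.range (o + 1)).map fun i => g * a ^ i : List G), ?_, ?_, ?_⟩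
  · rw [Cycle.nodup_coe_iff]
    refine List.Nodup.map_on ?_ List.nodup_range
    intro i hi j hj h
    rw [List.mem_range, ← ho'] at hi hj
    exact pow_injOn_Iio_orderOf hi hj (mul_left_cancel h)
  · intro x
    rw [Cycle.mem_coe_iff]
    simp only [List.mem_map, List.mem_range, Set.mem_ofPred_eq]
    constructor
    · rintro ⟨i, -, rfl⟩; exact ⟨i, rfl⟩
    · rintro ⟨i, rfl⟩
      exact ⟨i % (o + 1), Nat.mod_lt _ (by omega), by rw [← ho', pow_mod_orderOf]⟩
  · apply Cycle.chain_coe_of_getLast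
    · rw [List.isChain_iff_getElem]
      intro i hi
      left
      simp [pow_succ, mul_assoc]
    · intro x hx y hy
      left
      rw [List.getLast?_map, List.range_succ, List.getLast?_concat, Option.map_some,
        Option.mem_some_iff] at hx
      rw [List.range_succ_eq_map, List.map_cons, List.head?_cons, Option.mem_some_iff] at hy
      subst hx hy
      rw [mul_assoc, ← pow_succ, ← ho', pow_orderOf_eq_one, pow_zero]

/-- Hypertrees of `a`-cycles, with edges coming from cosets of the powers of `a * b⁻¹`, are
traversable. -/
theorem Traversable.of_hyperTree {V : Type*} {ok : V → Prop} {E : V → V → V → Prop} (H : Set G)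
    (κ : G → V) (hab : (a * b⁻¹) ^ 3 = 1)
    (hok : ∀ v, ok v → Traversable a b {g | g ∈ H ∧ κ g = v})
    (hE : ∀ p q r, ok p → ok q → ok r → E p q r → ∃ g ∈ H, g * (a * b⁻¹) ∈ H ∧
      g * (a * b⁻¹) * (a * b⁻¹) ∈ H ∧ κ g = p ∧
      ((κ (g * (a * b⁻¹)) = q ∧ κ (g * (a * b⁻¹) * (a * b⁻¹)) = r) ∨
        (κ (g * (a * b⁻¹)) = r ∧ κ (g * (a * b⁻¹) * (a * b⁻¹)) = q)))
    {S : Set V} (hS : HyperTree ok E S) : Traversable a b {g | g ∈ H ∧ κ g ∈ S} := by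
  have disj : ∀ {S T : Set V}, Disjoint S T →
      Disjoint {g | g ∈ H ∧ κ g ∈ S} {g | g ∈ H ∧ κ g ∈ T} := fun h =>
    Set.disjoint_left.2 fun g h1 h2 => Set.disjoint_left.1 h h1.2 h2.2
  induction hS with
  | single v hv => exact hok v hv
  | @join S T U p q r hS hT hU dST dSU dTU hp hq hr he ihS ihT ihU =>
    obtain ⟨g, hg, hg', hg'', h1, h2⟩ :=
      hE p q r (hS.ok_of_mem _ hp) (hT.ok_of_mem _ hq) (hU.ok_of_mem _ hr) he
    -- An edge is unordered, while multiplication by `a * b⁻¹` imposes a cyclic orientation; both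
    -- orientations merge.
    rcases h2 with ⟨h2, h3⟩ | ⟨h2, h3⟩
    · have := ihS.merge ihT ihU (disj dST) (disj dSU) (disj dTU) hab (g := g)
        ⟨hg, h1 ▸ hp⟩ ⟨hg', h2 ▸ hq⟩ ⟨hg'', h3 ▸ hr⟩
      convert this using 1
      ext x
      simp only [Set.mem_ofPred_eq, Set.mem_union]
      tauto
    · have := ihS.merge ihU ihT (disj dSU) (disj dST) (disj dTU).symm hab (g := g)
        ⟨hg, h1 ▸ hp⟩ ⟨hg', h2 ▸ hr⟩ ⟨hg'', h3 ▸ hq⟩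
      convert this using 1
      ext x
      simp only [Set.mem_ofPred_eq, Set.mem_union]
      tauto

end Merging

/-! ### Permutations, parity, and the dictionary with arrangements -/

section Perm

open Equiv

theorem val_cycleRange {n : ℕ} (j i : Fin n) :
    (Fin.cycleRange j i : ℕ) =
      if (i : ℕ) < j then (i : ℕ) + 1 else if (i : ℕ) = j then 0 else i := by
  have : NeZero n := ⟨by rintro rfl; exact i.elim0⟩
  rcases lt_trichotomy i j with h | rfl | h
  · rw [Fin.coe_cycleRange_of_lt h, if_pos (Fin.lt_def.1 h)]
  · simp
  · rw [Fin.cycleRange_of_gt h, if_neg (by have := Fin.lt_def.1 h; omega),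
      if_neg (by have := Fin.lt_def.1 h; omega)]

theorem val_cycleRange_inv {n : ℕ} (j i : Fin n) :
    ((Fin.cycleRange j)⁻¹ i : ℕ) =
      if (i : ℕ) = 0 then (j : ℕ) else if (i : ℕ) ≤ j then (i : ℕ) - 1 else i := by
  obtain ⟨x, rfl⟩ := (Fin.cycleRange j).surjective i
  rw [show (Fin.cycleRange j)⁻¹ (Fin.cycleRange j x) = x from Equiv.symm_apply_apply _ _]
  have h := val_cycleRange j x
  generalize Fin.cycleRange j x = y at *
  split_ifs at * <;> omega

/-- The cycle of the transition which moves the entry at index `l` to the top. -/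
def shortCycle (l : ℕ) : Perm (Fin (l + 4)) := (Fin.cycleRange ⟨l, by omega⟩)⁻¹

/-- The cycle of the transition which moves the entry at index `l + 2` to the top. -/
def longCycle (l : ℕ) : Perm (Fin (l + 4)) := (Fin.cycleRange ⟨l + 2, by omega⟩)⁻¹

/-- The cycle of the transition which moves the last entry to the top. -/
def fullCycle (l : ℕ) : Perm (Fin (l + 4)) := (Fin.cycleRange ⟨l + 3, by omega⟩)⁻¹

variable {l : ℕ}

theorem val_shortCycle (i : Fin (l + 4)) : (shortCycle l i : ℕ) =
    if (i : ℕ) = 0 then l else if (i : ℕ) ≤ l then (i : ℕ) - 1 else i :=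
  val_cycleRange_inv _ i

theorem val_longCycle (i : Fin (l + 4)) : (longCycle l i : ℕ) =
    if (i : ℕ) = 0 then l + 2 else if (i : ℕ) ≤ l + 2 then (i : ℕ) - 1 else i :=
  val_cycleRange_inv _ i

theorem val_fullCycle (i : Fin (l + 4)) : (fullCycle l i : ℕ) =
    if (i : ℕ) = 0 then l + 3 else (i : ℕ) - 1 := by
  rw [fullCycle, val_cycleRange_inv]
  simp only
  split_ifs <;> omega

theorem val_shortCycle_inv (i : Fin (l + 4)) : ((shortCycle l)⁻¹ i : ℕ) =
    if (i : ℕ) < l then (i : ℕ) + 1 else if (i : ℕ) = l then 0 else i := by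
  rw [shortCycle, inv_inv, val_cycleRange]

theorem val_longCycle_inv (i : Fin (l + 4)) : ((longCycle l)⁻¹ i : ℕ) =
    if (i : ℕ) < l + 2 then (i : ℕ) + 1 else if (i : ℕ) = l + 2 then 0 else i := by
  rw [longCycle, inv_inv, val_cycleRange]

theorem val_fullCycle_inv (i : Fin (l + 4)) : ((fullCycle l)⁻¹ i : ℕ) =
    if (i : ℕ) < l + 3 then (i : ℕ) + 1 else 0 := by
  rw [fullCycle, inv_inv, val_cycleRange]
  simp only
  split_ifs <;> omega

theorem sign_shortCycle (hl : Even l) : Perm.sign (shortCycle l) = 1 := by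
  rw [shortCycle, Perm.sign_inv, Fin.sign_cycleRange]
  exact hl.neg_one_pow

theorem sign_longCycle (hl : Even l) : Perm.sign (longCycle l) = 1 := by
  rw [longCycle, Perm.sign_inv, Fin.sign_cycleRange]
  exact (hl.add even_two).neg_one_pow

theorem sign_fullCycle (hl : Even l) : Perm.sign (fullCycle l) = -1 := by
  rw [fullCycle, Perm.sign_inv, Fin.sign_cycleRange]
  exact (hl.add_odd (by decide : Odd 3)).neg_one_pow

theorem orderOf_shortCycle (hl : l ≠ 0) : orderOf (shortCycle l) = l + 1 := by
  rw [shortCycle, orderOf_inv, ← Perm.lcm_cycleType, Fin.cycleType_cycleRange]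
  · simp
  · intro h
    exact hl (by simpa using congrArg Fin.val h)

/-- The even permutations which fix the last index. -/
def evenFixingLast (l : ℕ) : Subgroup (Perm (Fin (l + 4))) :=
  Perm.sign.ker ⊓ MulAction.stabilizer _ (Fin.last (l + 3))

theorem mem_evenFixingLast {g : Perm (Fin (l + 4))} :
    g ∈ evenFixingLast l ↔ Perm.sign g = 1 ∧ g (Fin.last (l + 3)) = Fin.last (l + 3) := by
  simp [evenFixingLast, Subgroup.mem_inf]

theorem shortCycle_mem (hl : Even l) : shortCycle l ∈ evenFixingLast l := by
  refine mem_evenFixingLast.2 ⟨sign_shortCycle hl, Fin.ext ?_⟩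
  simp [val_shortCycle]

theorem longCycle_mem (hl : Even l) : longCycle l ∈ evenFixingLast l := by
  refine mem_evenFixingLast.2 ⟨sign_longCycle hl, Fin.ext ?_⟩
  simp [val_longCycle]

theorem two_mul_card_evenFixingLast (l : ℕ) :
    2 * Nat.card (evenFixingLast l) = (l + 3).factorial := by
  have hpres : ∀ g ∈ evenFixingLast l, ∀ x, g x ≠ Fin.last (l + 3) ↔ x ≠ Fin.last (l + 3) := by
    intro g hg x
    have h := g.injective.eq_iff (a := x) (b := Fin.last (l + 3))
    rw [(mem_evenFixingLast.1 hg).2] at h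
    exact not_congr h
  have e : alternatingGroup {x : Fin (l + 4) // x ≠ Fin.last (l + 3)} ≃ evenFixingLast l :=
    { toFun := fun f => ⟨Perm.ofSubtype f.1, mem_evenFixingLast.2
        ⟨by rw [Perm.sign_ofSubtype]; exact f.2, Perm.ofSubtype_apply_of_not_mem _ (by simp)⟩⟩
      invFun := fun g => ⟨Perm.subtypePerm g.1 (hpres g.1 g.2), by
        rw [Perm.mem_alternatingGroup, Perm.sign_subtypePerm]
        · exact (mem_evenFixingLast.1 g.2).1
        · rintro x hx rfl
          exact hx (mem_evenFixingLast.1 g.2).2⟩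
      left_inv := fun f => Subtype.ext (Perm.subtypePerm_ofSubtype f.1)
      right_inv := fun g => Subtype.ext (Perm.ofSubtype_subtypePerm (hpres g.1 g.2) (by
        rintro x hx rfl
        exact hx (mem_evenFixingLast.1 g.2).2)) }
  have hc : Fintype.card {x : Fin (l + 4) // x ≠ Fin.last (l + 3)} = l + 3 := by
    rw [Fintype.card_subtype_compl]
    simp
  have : Nontrivial {x : Fin (l + 4) // x ≠ Fin.last (l + 3)} := by
    rw [← Fintype.one_lt_card_iff_nontrivial, hc]
    omega
  rw [← Nat.card_congr e, two_mul_nat_card_alternatingGroup, Nat.card_perm,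
    Nat.card_eq_fintype_card, hc]

/-- The indices other than the last one. -/
abbrev symbols (l : ℕ) : Finset (Fin (l + 4)) := Finset.univ.erase (Fin.last (l + 3))

theorem card_symbols (l : ℕ) : (symbols l).card = l + 3 := by
  rw [Finset.card_erase_of_mem (Finset.mem_univ _), Finset.card_univ, Fintype.card_fin]
  rfl

/-- The first `l + 1` entries. -/
def initialEntries (g : Perm (Fin (l + 4))) : List (Fin (l + 4)) :=
  List.ofFn fun i : Fin (l + 1) => g ⟨i, by omega⟩

theorem initialEntries_eq_append (g : Perm (Fin (l + 4))) :
    initialEntries g = (List.ofFn fun i : Fin l => g ⟨i, by omega⟩) ++ [g ⟨l, by omega⟩] := by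
  rw [initialEntries, List.ofFn_succ']
  simp

theorem initialEntries_mul_shortCycle (g : Perm (Fin (l + 4))) :
    (initialEntries g).IsRotated (initialEntries (g * shortCycle l)) := by
  rw [initialEntries_eq_append, initialEntries, List.ofFn_succ]
  have h0 : (g * shortCycle l) ⟨((0 : Fin (l + 1)) : ℕ), by omega⟩ = g ⟨l, by omega⟩ := by
    rw [Perm.mul_apply]
    congr 1
    apply Fin.ext
    simp [val_shortCycle]
  have h1 : ∀ i : Fin l, (g * shortCycle l) ⟨(i.succ : ℕ), by omega⟩ = g ⟨i, by omega⟩ := by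
    intro i
    rw [Perm.mul_apply]
    congr 1
    apply Fin.ext
    simp [val_shortCycle]
  rw [h0]
  simp only [h1]
  exact List.isRotated_append

theorem initialEntries_mul_pow (g : Perm (Fin (l + 4))) (i : ℕ) :
    (initialEntries g).IsRotated (initialEntries (g * shortCycle l ^ i)) := by
  induction i with
  | zero => simpa using List.IsRotated.refl _
  | succ i ih =>
    rw [pow_succ, ← mul_assoc]
    exact ih.trans (initialEntries_mul_shortCycle _)

/-- The inverse of `shortCycle` rotates the initial entries by one place; as the order is finite,
its powers are also natural powers of `shortCycle`. -/
theorem initialEntries_mul_pow_of_rotate (g : Perm (Fin (l + 4))) (i : ℕ) :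
    ∃ j, initialEntries (g * shortCycle l ^ j) = (initialEntries g).rotate i := by
  have step : ∀ h : Perm (Fin (l + 4)),
      initialEntries (h * (shortCycle l)⁻¹) = (initialEntries h).rotate 1 := by
    intro h
    have h0 : (h * (shortCycle l)⁻¹) ⟨l, by omega⟩ = h ⟨((0 : Fin (l + 1)) : ℕ), by omega⟩ := by
      rw [Perm.mul_apply]
      congr 1
      apply Fin.ext
      rw [val_shortCycle_inv]
      simp
    have h1 : ∀ i : Fin l,
        (h * (shortCycle l)⁻¹) ⟨i, by omega⟩ = h ⟨(i.succ : ℕ), by omega⟩ := by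
      intro i
      rw [Perm.mul_apply]
      congr 1
      apply Fin.ext
      rw [val_shortCycle_inv]
      simp
    rw [initialEntries_eq_append, initialEntries, List.ofFn_succ, h0]
    simp only [h1]
    simp
  have hpow : ∀ i : ℕ, initialEntries (g * (shortCycle l)⁻¹ ^ i) = (initialEntries g).rotate i := by
    intro i
    induction i with
    | zero => simp
    | succ i ih => rw [pow_succ, ← mul_assoc, step, ih, List.rotate_rotate]
  obtain ⟨j, hj⟩ := (Submonoid.mem_powers_iff ((shortCycle l)⁻¹ ^ i) (shortCycle l)).1 (by
    rw [mem_powers_iff_mem_zpowers]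
    exact pow_mem (inv_mem (Subgroup.mem_zpowers _)) i)
  exact ⟨j, by rw [hj, hpow]⟩

theorem isArrangement_initialEntries {g : Perm (Fin (l + 4))} (hg : g ∈ evenFixingLast l) :
    IsArrangement (symbols l) (l + 1) (initialEntries g) := by
  refine ⟨?_, ?_, by simp [initialEntries]⟩
  · rw [initialEntries, List.nodup_ofFn]
    intro i j h
    have := congrArg Fin.val (g.injective h)
    exact Fin.ext this
  · intro x hx
    rw [initialEntries, List.mem_ofFn] at hx
    obtain ⟨i, rfl⟩ := hx
    rw [Finset.mem_erase]
    refine ⟨fun h => ?_, Finset.mem_univ _⟩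
    rw [← (mem_evenFixingLast.1 hg).2] at h
    have := congrArg Fin.val (g.injective h)
    simp at this
    omega

/-- An even permutation fixing the last index is determined by its first `l + 1` entries. -/
theorem eq_of_initialEntries_eq {g h : Perm (Fin (l + 4))} (hg : g ∈ evenFixingLast l)
    (hh : h ∈ evenFixingLast l) (he : initialEntries g = initialEntries h) : g = h := by
  have hgh : g⁻¹ * h ∈ evenFixingLast l := mul_mem (inv_mem hg) hh
  obtain ⟨hs, hlast⟩ := mem_evenFixingLast.1 hgh
  set f := g⁻¹ * h with hf
  have hfix : ∀ i : Fin (l + 4), (i : ℕ) < l + 1 → f i = i := by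
    intro i hi
    rw [hf, Perm.mul_apply, Perm.inv_eq_iff_eq]
    have := congrFun (List.ofFn_injective he) ⟨i, hi⟩
    exact this.symm
  have hfixlast : ∀ i : Fin (l + 4), (i : ℕ) = l + 3 → f i = i := by
    intro i hi
    have : i = Fin.last (l + 3) := Fin.ext hi
    rw [this, hlast]
  have hval : ∀ i : Fin (l + 4), l + 1 ≤ (i : ℕ) → (i : ℕ) ≤ l + 2 →
      l + 1 ≤ (f i : ℕ) ∧ (f i : ℕ) ≤ l + 2 := by
    intro i h1 h2
    by_contra hcon
    have : f (f i) = f i := by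
      by_cases h3 : (f i : ℕ) < l + 1
      · exact hfix _ h3
      · exact hfixlast _ (by omega)
    have := congrArg Fin.val (f.injective this)
    omega
  let p : Fin (l + 4) := ⟨l + 1, by omega⟩
  let q : Fin (l + 4) := ⟨l + 2, by omega⟩
  have hpq : p ≠ q := by simp [p, q, Fin.ext_iff]
  -- Only the indices `l + 1` and `l + 2` remain free, and the sign excludes exchanging them.
  have hcases : f = 1 ∨ f = swap p q := by
    have hp := hval p (by simp [p]) (by simp [p])
    have hq := hval q (by simp [q]) (by simp [q])
    have hfpq : (f p : ℕ) ≠ f q := fun h => hpq (f.injective (Fin.ext h))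
    by_cases h : (f p : ℕ) = l + 1
    · left
      ext i
      rw [Perm.one_apply]
      by_cases h1 : (i : ℕ) < l + 1
      · rw [hfix i h1]
      by_cases h2 : (i : ℕ) = l + 3
      · rw [hfixlast i h2]
      by_cases h3 : (i : ℕ) = l + 1
      · rw [show i = p from Fin.ext h3, h]
      · rw [show i = q from Fin.ext (by simp only [q]; omega)]
        simp only [q] at *
        omega
    · right
      have hfp : f p = q := Fin.ext (by simp only [q]; omega)
      have hfq : f q = p := Fin.ext (by simp only [p] at *; omega)
      ext i
      by_cases h1 : i = p
      · rw [h1, hfp, swap_apply_left]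
      by_cases h2 : i = q
      · rw [h2, hfq, swap_apply_right]
      rw [swap_apply_of_ne_of_ne h1 h2]
      have h1' : (i : ℕ) ≠ l + 1 := fun h => h1 (Fin.ext h)
      have h2' : (i : ℕ) ≠ l + 2 := fun h => h2 (Fin.ext h)
      by_cases h3 : (i : ℕ) < l + 1
      · rw [hfix i h3]
      · rw [hfixlast i (by omega)]
  rcases hcases with h1 | h1
  · rw [hf] at h1
    exact inv_mul_eq_one.1 h1
  · rw [h1, Perm.sign_swap hpq] at hs
    exact absurd hs (by decide)

/-- Two symbols are left over for the indices `l + 1` and `l + 2`; exactly one of their two orders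
gives an even permutation. -/
theorem exists_initialEntries_eq {s : List (Fin (l + 4))} (hs : IsArrangement (symbols l) (l + 1) s) :
    ∃ g ∈ evenFixingLast l, initialEntries g = s := by
  have hsub : s.toFinset ⊆ symbols l := fun x hx => hs.2.1 x (by simpa using hx)
  have hcard : (symbols l \ s.toFinset).card = 2 := by
    rw [Finset.card_sdiff_of_subset hsub, card_symbols, List.toFinset_card_of_nodup hs.1, hs.2.2]
    omega
  obtain ⟨p, q, hpq, he⟩ := Finset.card_eq_two.1 hcard
  have hp : p ∈ symbols l \ s.toFinset := by simp [he]
  have hq : q ∈ symbols l \ s.toFinset := by simp [he]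
  rw [Finset.mem_sdiff, List.mem_toFinset, Finset.mem_erase] at hp hq
  have hlast : Fin.last (l + 3) ∉ s := fun h => (Finset.mem_erase.1 (hs.2.1 _ h)).1 rfl
  have hn : (s ++ [p, q, Fin.last (l + 3)]).Nodup := by
    refine List.nodup_append'.2 ⟨hs.1, ?_, ?_⟩
    · simp [hpq, hp.1.1, hq.1.1]
    · intro x hx hx'
      simp only [List.mem_cons, List.not_mem_nil, or_false] at hx'
      rcases hx' with rfl | rfl | rfl
      exacts [hp.2 hx, hq.2 hx, hlast hx]
  have hlen : (s ++ [p, q, Fin.last (l + 3)]).length = l + 4 := by simp [hs.2.2]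
  have hinj : Function.Injective fun i : Fin (l + 4) =>
      (s ++ [p, q, Fin.last (l + 3)])[(i : ℕ)]'(by rw [hlen]; exact i.2) := by
    intro i j h
    exact Fin.ext ((hn.getElem_inj_iff).1 h)
  let g : Perm (Fin (l + 4)) := Equiv.ofBijective _ (Finite.injective_iff_bijective.1 hinj)
  have hg : ∀ i : Fin (l + 4), g i =
      (s ++ [p, q, Fin.last (l + 3)])[(i : ℕ)]'(by rw [hlen]; exact i.2) := fun i => rfl
  have hgl : g (Fin.last (l + 3)) = Fin.last (l + 3) := by
    rw [hg]
    simp [List.getElem_append_right, hs.2.2]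
  have hgs : initialEntries g = s := by
    refine List.ext_getElem (by simp [initialEntries, hs.2.2]) fun i h1 h2 => ?_
    simp only [initialEntries, List.getElem_ofFn, hg]
    rw [List.getElem_append_left]
  by_cases hsg : Perm.sign g = 1
  · exact ⟨g, mem_evenFixingLast.2 ⟨hsg, hgl⟩, hgs⟩
  · have hne : (⟨l + 1, by omega⟩ : Fin (l + 4)) ≠ ⟨l + 2, by omega⟩ := by simp
    refine ⟨g * swap ⟨l + 1, by omega⟩ ⟨l + 2, by omega⟩, mem_evenFixingLast.2 ⟨?_, ?_⟩, ?_⟩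
    · rw [Perm.sign_mul, Perm.sign_swap hne, (Int.units_eq_one_or _).resolve_left hsg]
      rfl
    · rw [Perm.mul_apply, swap_apply_of_ne_of_ne (by simp [Fin.ext_iff]) (by simp [Fin.ext_iff]),
        hgl]
    · refine Eq.trans ?_ hgs
      simp only [initialEntries]
      congr 1
      ext i
      rw [Perm.mul_apply, swap_apply_of_ne_of_ne] <;> simp only [ne_eq, Fin.mk.injEq] <;> omega

/-- This identifies the `shortCycle`-cosets in `evenFixingLast l` with the cyclic arrangements. -/
theorem initialEntries_isRotated_iff {g h : Perm (Fin (l + 4))} (hl : Even l)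
    (hg : g ∈ evenFixingLast l) (hh : h ∈ evenFixingLast l) :
    (initialEntries g).IsRotated (initialEntries h) ↔ ∃ i : ℕ, h = g * shortCycle l ^ i := by
  constructor
  · rintro ⟨i, hi⟩
    obtain ⟨j, hj⟩ := initialEntries_mul_pow_of_rotate g i
    exact ⟨j, (eq_of_initialEntries_eq (mul_mem hg (pow_mem (shortCycle_mem hl) j)) hh
      (hj.trans hi)).symm⟩
  · rintro ⟨i, rfl⟩
    exact initialEntries_mul_pow g i

/-- The product is the 3-cycle `l ↦ l + 1 ↦ l + 2 ↦ l`; this gives both the order 3 needed for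
merging and the change of a single initial entry. -/
theorem val_shortCycle_mul_longCycle_inv (i : Fin (l + 4)) :
    ((shortCycle l * (longCycle l)⁻¹) i : ℕ) =
      if (i : ℕ) = l then l + 1 else if (i : ℕ) = l + 1 then l + 2 else
        if (i : ℕ) = l + 2 then l else i := by
  rw [Perm.mul_apply, val_shortCycle]
  have h := val_longCycle_inv i
  generalize (longCycle l)⁻¹ i = j at *
  split_ifs at * <;> omega

theorem shortCycle_mul_longCycle_inv_pow : (shortCycle l * (longCycle l)⁻¹) ^ 3 = 1 := by
  ext i
  rw [pow_succ, pow_two, Perm.mul_apply, Perm.mul_apply, Perm.one_apply]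
  have h1 := val_shortCycle_mul_longCycle_inv i
  have h2 := val_shortCycle_mul_longCycle_inv ((shortCycle l * (longCycle l)⁻¹) i)
  rw [val_shortCycle_mul_longCycle_inv]
  generalize (shortCycle l * (longCycle l)⁻¹) i = j at *
  generalize (shortCycle l * (longCycle l)⁻¹) j = t at *
  split_ifs at * <;> omega

theorem initialEntries_mul_of_fixed {g c : Perm (Fin (l + 4))}
    (hc : ∀ i : Fin (l + 4), (i : ℕ) < l → c i = i) :
    initialEntries (g * c) =
      (List.ofFn fun i : Fin l => g ⟨i, by omega⟩) ++ [g (c ⟨l, by omega⟩)] := by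
  rw [initialEntries_eq_append]
  congr 2
  ext i
  rw [Perm.mul_apply, hc _ i.2]

/-- Rotate so that the varying symbol stands at index `l`. The 3-cycle then brings the entries at `l
+ 1` and `l + 2` there in turn. These are `y` and `z`, in an order dictated by parity. -/
theorem exists_of_cyclicArrangementEdge (hl : Even l) (P Q R : Cycle (Fin (l + 4)))
    (hP : IsCyclicArrangement (symbols l) (l + 1) P)
    (h : CyclicArrangementEdge (symbols l) P Q R) :
    ∃ g ∈ evenFixingLast l, g * (shortCycle l * (longCycle l)⁻¹) ∈ evenFixingLast l ∧
      g * (shortCycle l * (longCycle l)⁻¹) * (shortCycle l * (longCycle l)⁻¹) ∈ evenFixingLast l ∧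
      (initialEntries g : Cycle (Fin (l + 4))) = P ∧
      (((initialEntries (g * (shortCycle l * (longCycle l)⁻¹)) : Cycle (Fin (l + 4))) = Q ∧
        (initialEntries (g * (shortCycle l * (longCycle l)⁻¹) * (shortCycle l * (longCycle l)⁻¹)) :
          Cycle (Fin (l + 4))) = R) ∨
      ((initialEntries (g * (shortCycle l * (longCycle l)⁻¹)) : Cycle (Fin (l + 4))) = R ∧
        (initialEntries (g * (shortCycle l * (longCycle l)⁻¹) * (shortCycle l * (longCycle l)⁻¹)) :
          Cycle (Fin (l + 4))) = Q)) := by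
  obtain ⟨s, x, y, z, rfl, rfl, rfl, hn, hm⟩ := h
  obtain ⟨s', hs', hP⟩ := hP
  have hP' := hP.isRotated (Cycle.coe_eq_coe.1 hs').symm
  have hslen : s.length = l := by simpa using hP'.2.2
  have hrot : ∀ t : Fin (l + 4), ((s ++ [t] : List _) : Cycle (Fin (l + 4))) = (t :: s : List _) :=
    fun t => Cycle.coe_eq_coe.2 (List.isRotated_append (l' := [t]))
  obtain ⟨g, hg, hgs⟩ := exists_initialEntries_eq
    (hP'.isRotated (List.isRotated_append (l := [x]) (l' := s)))
  have hc := mul_mem (shortCycle_mem hl) (inv_mem (longCycle_mem hl))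
  have hval := val_shortCycle_mul_longCycle_inv (l := l)
  set c := shortCycle l * (longCycle l)⁻¹ with hcdef
  have hcfix : ∀ i : Fin (l + 4), (i : ℕ) < l → c i = i := by
    intro i hi
    apply Fin.ext
    rw [hval]
    split_ifs <;> omega
  have hgs' := hgs
  rw [initialEntries_eq_append] at hgs'
  obtain ⟨hs1, hx⟩ := List.append_inj' hgs' rfl
  have hx : g ⟨l, by omega⟩ = x := by simpa using hx
  have e1 : c ⟨l, by omega⟩ = ⟨l + 1, by omega⟩ := Fin.ext (by rw [hval]; simp)
  have e2 : c ⟨l + 1, by omega⟩ = ⟨l + 2, by omega⟩ := Fin.ext (by rw [hval]; simp)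
  have k1 : initialEntries (g * c) = s ++ [g ⟨l + 1, by omega⟩] := by
    rw [initialEntries_mul_of_fixed hcfix, hs1, e1]
  have k2 : initialEntries (g * c * c) = s ++ [g ⟨l + 2, by omega⟩] := by
    rw [mul_assoc, initialEntries_mul_of_fixed (by
      intro i hi
      rw [Perm.mul_apply, hcfix i hi, hcfix i hi]), hs1, Perm.mul_apply, e1, e2]
  have hin : ∀ t ∈ symbols l, t = x ∨ t = y ∨ t = z ∨ t ∈ s := by
    intro t ht
    have harr : IsArrangement (symbols l) (symbols l).card (x :: y :: z :: s) :=
      ⟨hn, hm, by simp [hslen]⟩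
    simpa using harr.mem_iff.2 ht
  have hyz : ∀ (j : ℕ) (hj : j < l + 4), l < j → j < l + 3 → g ⟨j, hj⟩ = y ∨ g ⟨j, hj⟩ = z := by
    intro j hj h1 h2
    have ht : g ⟨j, hj⟩ ∈ symbols l := by
      rw [Finset.mem_erase]
      refine ⟨fun h => ?_, Finset.mem_univ _⟩
      rw [← (mem_evenFixingLast.1 hg).2] at h
      have := congrArg Fin.val (g.injective h)
      simp at this
      omega
    rcases hin _ ht with h | h | h | h
    · rw [← hx] at h
      have := congrArg Fin.val (g.injective h)
      simp at this
      omega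
    · exact .inl h
    · exact .inr h
    · rw [← hs1, List.mem_ofFn] at h
      obtain ⟨i, hi⟩ := h
      have := congrArg Fin.val (g.injective hi)
      simp at this
      omega
  have hne : g ⟨l + 1, by omega⟩ ≠ g ⟨l + 2, by omega⟩ := fun h => by
    simpa using congrArg Fin.val (g.injective h)
  refine ⟨g, hg, mul_mem hg hc, mul_mem (mul_mem hg hc) hc, by rw [hgs, hrot], ?_⟩
  rw [k1, k2, hrot, hrot]
  rcases hyz (l + 1) (by omega) (by omega) (by omega) with h1 | h1 <;>
    rcases hyz (l + 2) (by omega) (by omega) (by omega) with h2 | h2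
  · exact absurd (h1.trans h2.symm) hne
  · rw [h1, h2]; exact .inl ⟨rfl, rfl⟩
  · rw [h1, h2]; exact .inr ⟨rfl, rfl⟩
  · exact absurd (h1.trans h2.symm) hne

/-- There is a cycle of the transitions `shortCycle` and `longCycle` through all even permutations
fixing the last index, except for the orbit of one permutation under `shortCycle`. -/
theorem exists_traversable (hl : Even l) (hl2 : 2 ≤ l) :
    ∃ g ∈ evenFixingLast l, Traversable (shortCycle l) (longCycle l)
      {x | x ∈ evenFixingLast l ∧ ∀ i : ℕ, x ≠ g * shortCycle l ^ i} := by
  obtain ⟨s, hs, hT⟩ := exists_hyperTree_cyclicArrangements (k := l + 1) (by omega) hl.add_one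
    (symbols l) (card_symbols l)
  obtain ⟨g, hg, rfl⟩ := exists_initialEntries_eq hs
  refine ⟨g, hg, ?_⟩
  have := Traversable.of_hyperTree (a := shortCycle l) (b := longCycle l)
    (evenFixingLast l : Set (Perm (Fin (l + 4))))
    (fun g => (initialEntries g : Cycle (Fin (l + 4)))) shortCycle_mul_longCycle_inv_pow
    (by
      rintro _ ⟨t, rfl, ht⟩
      obtain ⟨h, hh, rfl⟩ := exists_initialEntries_eq ht
      convert Traversable.of_powers (shortCycle l) (longCycle l) h using 1
      ext x
      simp only [Set.mem_ofPred_eq, SetLike.mem_coe, Cycle.coe_eq_coe]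
      constructor
      · rintro ⟨hx, hrot⟩
        exact (initialEntries_isRotated_iff hl hh hx).1 hrot.symm
      · rintro ⟨i, rfl⟩
        exact ⟨mul_mem hh (pow_mem (shortCycle_mem hl) i), (initialEntries_mul_pow h i).symm⟩)
    (fun P Q R hP _ _ h => exists_of_cyclicArrangementEdge hl P Q R hP h) hT
  convert this using 1
  ext x
  simp only [Set.mem_ofPred_eq, SetLike.mem_coe]
  refine and_congr_right fun hx => ⟨fun h => ⟨⟨_, rfl, isArrangement_initialEntries hx⟩, ?_⟩, ?_⟩
  · intro hrot
    obtain ⟨i, hi⟩ := (initialEntries_isRotated_iff hl hg hx).1 (Cycle.coe_eq_coe.1 hrot).symm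
    exact h i hi
  · rintro ⟨-, h⟩ i rfl
    exact h (Cycle.coe_eq_coe.2 (initialEntries_mul_pow g i).symm)

end Perm

/-! ### The path through almost all even permutations fixing the last index -/

section Path

open Equiv

variable {l : ℕ}

/-- `y` arises from `x` by a push-to-the-top transition. -/
def IsPush {n : ℕ} (x y : Perm (Fin n)) : Prop := ∃ j : Fin n, 0 < (j : ℕ) ∧ y = pushToTop j x

theorem IsPush.mul_left {n : ℕ} {x y : Perm (Fin n)} (h : IsPush x y) (g : Perm (Fin n)) :
    IsPush (g * x) (g * y) := by
  obtain ⟨j, hj, rfl⟩ := h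
  exact ⟨j, hj, (mul_assoc _ _ _).symm⟩

theorem isPush_shortCycle (hl : l ≠ 0) (x : Perm (Fin (l + 4))) : IsPush x (x * shortCycle l) :=
  ⟨⟨l, by omega⟩, by simp only; omega, rfl⟩

theorem isPush_longCycle (x : Perm (Fin (l + 4))) : IsPush x (x * longCycle l) :=
  ⟨⟨l + 2, by omega⟩, by simp only; omega, rfl⟩

theorem isPush_fullCycle (x : Perm (Fin (l + 4))) : IsPush x (x * fullCycle l) :=
  ⟨⟨l + 3, by omega⟩, by simp only; omega, rfl⟩

theorem longCycle_ne_shortCycle_pow (i : ℕ) : longCycle l ≠ shortCycle l ^ i := by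
  intro h
  have hfix : (shortCycle l ^ i) ⟨l + 2, by omega⟩ = ⟨l + 2, by omega⟩ := by
    apply Perm.pow_apply_eq_self_of_apply_eq_self
    apply Fin.ext
    rw [val_shortCycle]
    simp
  rw [← h] at hfix
  have := congrArg Fin.val hfix
  rw [val_longCycle] at this
  simp at this

/-- A path of push-to-the-top transitions through almost all even permutations fixing the last
index. -/
theorem exists_path (hl : Even l) (hl2 : 2 ≤ l) :
    ∃ L : List (Perm (Fin (l + 4))), L.Nodup ∧ L.IsChain IsPush ∧ L.head? = some 1 ∧
      L.getLast? = some (shortCycle l)⁻¹ ∧ (∀ g ∈ L, g ∈ evenFixingLast l) ∧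
      (longCycle l)⁻¹ ∉ L ∧ 2 * (L.length + (l + 1)) = (l + 3).factorial := by
  obtain ⟨g, hg, s, hn, hm, hc⟩ := exists_traversable hl hl2
  -- The cycle is started at `g * longCycle l`, with `g` in the missed coset, and translated so that
  -- this point becomes `1`; then `g` itself becomes the missed element `(longCycle l)⁻¹`.
  have hx : g * longCycle l ∈ s := by
    rw [hm]
    exact ⟨mul_mem hg (longCycle_mem hl), fun i h =>
      longCycle_ne_shortCycle_pow i (mul_left_cancel h)⟩
  induction s using Quotient.inductionOn' with
  | _ L₀
  obtain ⟨L, hL⟩ := exists_cons_isRotated (hx : g * longCycle l ∈ L₀)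
  have hLc : (Quotient.mk'' L₀ : Cycle _) = ((g * longCycle l :: L : List _) : Cycle _) :=
    Cycle.coe_eq_coe.2 hL
  rw [hLc] at hn hm hc
  rw [Cycle.nodup_coe_iff] at hn
  rw [Cycle.chain_coe_cons, ← List.cons_append, List.isChain_append] at hc
  simp only [Cycle.mem_coe_iff] at hm
  have hpush : ∀ S x y, SwitchStep (shortCycle l) (longCycle l) S x y → IsPush x y := by
    rintro S x y (rfl | ⟨rfl, -⟩)
    exacts [isPush_shortCycle (by omega) x, isPush_longCycle x]
  set C := g * longCycle l :: L with hC
  refine ⟨C.map fun x => (g * longCycle l)⁻¹ * x, hn.map (mul_right_injective _), ?_, ?_, ?_, ?_,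
    ?_, ?_⟩
  · rw [List.isChain_map]
    exact hc.1.imp fun x y h => (hpush _ _ _ h).mul_left _
  · simp [hC]
  · obtain ⟨p, hp⟩ : ∃ p, C.getLast? = some p :=
      ⟨_, List.getLast?_eq_getLast_of_ne_nil (by simp [hC])⟩
    rw [List.getLast?_map, hp, Option.map_some, Option.some_inj]
    have hpC : p ∈ C := List.mem_of_getLast? hp
    -- The closing step is an `a`-step: a `b`-step into `g * longCycle l` would come from `g`, which
    -- is not on the cycle.
    rcases hc.2.2 p hp _ rfl with h | ⟨h, -⟩
    · rw [h]; group
    · have := ((hm p).1 hpC).2 0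
      rw [← mul_right_cancel h] at this
      simp at this
  · intro x hx
    obtain ⟨y, hy, rfl⟩ := List.mem_map.1 hx
    exact mul_mem (inv_mem (mul_mem hg (longCycle_mem hl))) ((hm y).1 hy).1
  · intro h
    obtain ⟨y, hy, h⟩ := List.mem_map.1 h
    have : y = g := by
      rw [inv_mul_eq_iff_eq_mul] at h
      rw [h]; group
    subst this
    simpa using ((hm y).1 hy).2 0
  · rw [← two_mul_card_evenFixingLast, List.length_map]
    -- The missed coset, of size `l + 1`, completes the cycle to the whole group.
    set O := (List.range (l + 1)).map fun i => g * shortCycle l ^ i with hO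
    have ho := orderOf_shortCycle (l := l) (by omega)
    have hnd : (C ++ O).Nodup := by
      refine List.nodup_append'.2 ⟨hn, List.Nodup.map_on ?_ List.nodup_range, ?_⟩
      · intro i hi j hj h
        rw [List.mem_range, ← ho] at hi hj
        exact pow_injOn_Iio_orderOf hi hj (mul_left_cancel h)
      · intro x hx hx'
        obtain ⟨i, -, rfl⟩ := List.mem_map.1 hx'
        exact ((hm _).1 hx).2 i rfl
    have hcard := Nat.subtype_card (p := fun x => x ∈ evenFixingLast l) (C ++ O).toFinset (by
      intro x
      rw [List.mem_toFinset, List.mem_append, hm]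
      constructor
      · rintro (h | h)
        · exact h.1
        · obtain ⟨i, -, rfl⟩ := List.mem_map.1 h
          exact mul_mem hg (pow_mem (shortCycle_mem hl) i)
      · intro hx
        by_cases h : ∃ i : ℕ, x = g * shortCycle l ^ i
        · obtain ⟨i, rfl⟩ := h
          refine .inr (List.mem_map.2 ⟨i % (l + 1), List.mem_range.2 (Nat.mod_lt _ (by omega)), ?_⟩)
          rw [← ho, pow_mod_orderOf]
        · exact .inl ⟨hx, fun i hi => h ⟨i, hi⟩⟩)
    rw [List.toFinset_card_of_nodup hnd, List.length_append, hO, List.length_map,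
      List.length_range] at hcard
    rw [← hcard]

end Path

/-! ### Gluing translated paths into a snake -/

section Blocks

open Equiv

/-- The translation from one block of the code to the next. -/
def blockShift (l : ℕ) : Perm (Fin (l + 4)) := (shortCycle l)⁻¹ * fullCycle l * fullCycle l

variable {l : ℕ}

/-- The cycles are `0 ↔ l + 2` and `l + 3 ↦ l + 1 ↦ l ↦ ⋯ ↦ 1 ↦ l + 3`, of lengths 2 and `l + 2`.
For even `l` the order therefore divides `l + 2`, and the orbits of `l + 3` and `l + 2` are
disjoint. -/
theorem val_blockShift (i : Fin (l + 4)) : (blockShift l i : ℕ) =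
    if (i : ℕ) = 0 then l + 2 else if (i : ℕ) = 1 then l + 3 else if (i : ℕ) = l + 2 then 0 else
      if (i : ℕ) = l + 3 then l + 1 else (i : ℕ) - 1 := by
  rw [blockShift, Perm.mul_apply, Perm.mul_apply, val_shortCycle_inv]
  have h1 := val_fullCycle (fullCycle l i)
  have h2 := val_fullCycle i
  generalize fullCycle l i = j at *
  generalize fullCycle l j = t at *
  split_ifs at * <;> omega

theorem sign_blockShift (hl : Even l) : Perm.sign (blockShift l) = 1 := by
  rw [blockShift, Perm.sign_mul, Perm.sign_mul, Perm.sign_inv, sign_shortCycle hl,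
    sign_fullCycle hl]
  rfl

theorem val_blockShift_pow_last {i : ℕ} (hi : i < l + 2) :
    ((blockShift l ^ i) (Fin.last (l + 3)) : ℕ) = if i = 0 then l + 3 else l + 2 - i := by
  induction i with
  | zero => simp
  | succ i ih =>
    have ih := ih (by omega)
    rw [pow_succ', Perm.mul_apply, val_blockShift]
    generalize (blockShift l ^ i) (Fin.last (l + 3)) = y at *
    split_ifs at * <;> omega

theorem val_blockShift_pow_penultimate (i : ℕ) :
    ((blockShift l ^ i) ⟨l + 2, by omega⟩ : ℕ) = if Even i then l + 2 else 0 := by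
  induction i with
  | zero => simp
  | succ i ih =>
    rw [pow_succ', Perm.mul_apply, val_blockShift, ih]
    by_cases h : Even i
    · simp [h, Nat.even_add_one]
    · simp [h, Nat.even_add_one]

theorem blockShift_pow_eq_one (hl : Even l) : blockShift l ^ (l + 2) = 1 := by
  have hlast : (blockShift l ^ (l + 2)) (Fin.last (l + 3)) = Fin.last (l + 3) := by
    apply Fin.ext
    rw [pow_succ', Perm.mul_apply, val_blockShift, val_blockShift_pow_last (by omega)]
    simp
  have hpen : (blockShift l ^ (l + 2)) ⟨l + 2, by omega⟩ = ⟨l + 2, by omega⟩ := by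
    apply Fin.ext
    rw [val_blockShift_pow_penultimate, if_pos (hl.add even_two)]
  -- Points fixed by `blockShift ^ (l + 2)` are stable under powers of `blockShift`, so one point of
  -- each cycle suffices.
  have hmove : ∀ (i : ℕ) (x y : Fin (l + 4)), (blockShift l ^ (l + 2)) x = x →
      (blockShift l ^ i) x = y → (blockShift l ^ (l + 2)) y = y := by
    rintro i x y hx rfl
    rw [← Perm.mul_apply, pow_mul_comm, Perm.mul_apply, hx]
  refine Equiv.ext fun x => ?_
  rw [Perm.one_apply]
  have hx4 := x.2
  by_cases h0 : (x : ℕ) = 0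
  · exact hmove 1 _ x hpen (Fin.ext (by rw [val_blockShift_pow_penultimate]; simp [h0]))
  by_cases h2 : (x : ℕ) = l + 2
  · exact hmove 0 _ x hpen (Fin.ext (by simp [h2]))
  by_cases h3 : (x : ℕ) = l + 3
  · exact hmove 0 _ x hlast (Fin.ext (by simp [h3]))
  · refine hmove (l + 2 - x) _ x hlast (Fin.ext ?_)
    rw [val_blockShift_pow_last (by omega), if_neg (by omega)]
    omega

theorem blockShift_pow_injOn {i j : ℕ} (hi : i < l + 2) (hj : j < l + 2)
    (h : (blockShift l ^ i) (Fin.last (l + 3)) = (blockShift l ^ j) (Fin.last (l + 3))) :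
    i = j := by
  have := congrArg Fin.val h
  rw [val_blockShift_pow_last hi, val_blockShift_pow_last hj] at this
  split_ifs at this <;> omega

/-- Locates the neighbour, under the swap of the last two places, of the odd permutation preceding a
block: in the coordinates of that block it is `(longCycle l)⁻¹`, which the path misses. -/
theorem fullCycle_inv_mul_swap :
    (fullCycle l)⁻¹ * swap ⟨l + 2, by omega⟩ ⟨l + 3, by omega⟩ = (longCycle l)⁻¹ := by
  ext i
  rw [Perm.mul_apply, val_fullCycle_inv, val_longCycle_inv]
  by_cases h2 : i = ⟨l + 2, by omega⟩
  · rw [h2, swap_apply_left]; simp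
  by_cases h3 : i = ⟨l + 3, by omega⟩
  · rw [h3, swap_apply_right]; simp
  rw [swap_apply_of_ne_of_ne h2 h3]
  have hi := i.2
  have h2' : (i : ℕ) ≠ l + 2 := fun h => h2 (Fin.ext h)
  have h3' : (i : ℕ) ≠ l + 3 := fun h => h3 (Fin.ext h)
  split_ifs <;> omega

/-- The translate of the path `L` by `g`, followed by one odd permutation. -/
def block (L : List (Perm (Fin (l + 4)))) (g : Perm (Fin (l + 4))) : List (Perm (Fin (l + 4))) :=
  L.map (g * ·) ++ [g * (shortCycle l)⁻¹ * fullCycle l]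

/-- The concatenation of the first `n` blocks. -/
def blocks (L : List (Perm (Fin (l + 4)))) (n : ℕ) : List (Perm (Fin (l + 4))) :=
  (List.range n).flatMap fun i => block L (blockShift l ^ i)

theorem length_blocks (L : List (Perm (Fin (l + 4)))) (n : ℕ) :
    (blocks L n).length = n * (L.length + 1) := by
  simp [blocks, block, List.length_flatMap]

theorem blocks_succ (L : List (Perm (Fin (l + 4)))) (n : ℕ) :
    blocks L (n + 1) = blocks L n ++ block L (blockShift l ^ n) := by
  simp [blocks, List.range_succ]

theorem mem_blocks {L : List (Perm (Fin (l + 4)))} {n : ℕ} {x : Perm (Fin (l + 4))} :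
    x ∈ blocks L n ↔ ∃ i < n, x ∈ block L (blockShift l ^ i) := by
  simp [blocks]

theorem mem_block {L : List (Perm (Fin (l + 4)))} {g x : Perm (Fin (l + 4))} :
    x ∈ block L g ↔ (∃ h ∈ L, x = g * h) ∨ x = g * (shortCycle l)⁻¹ * fullCycle l := by
  simp [block, eq_comm]

theorem head?_blocks {L : List (Perm (Fin (l + 4)))} (hhead : L.head? = some 1) {n : ℕ}
    (hn : n ≠ 0) : (blocks L n).head? = some 1 := by
  obtain ⟨n, rfl⟩ := Nat.exists_eq_succ_of_ne_zero hn
  rw [blocks, Nat.succ_eq_add_one, List.range_succ_eq_map, List.flatMap_cons, block,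
    List.head?_append, List.head?_append, List.head?_map, hhead]
  simp

theorem getLast?_blocks (L : List (Perm (Fin (l + 4)))) (n : ℕ) :
    ∀ x ∈ (blocks L n).getLast?, x * fullCycle l = blockShift l ^ n := by
  intro x hx
  cases n with
  | zero => simp [blocks] at hx
  | succ n =>
    rw [blocks_succ, block, ← List.append_assoc, List.getLast?_concat, Option.mem_some_iff] at hx
    rw [← hx, pow_succ, blockShift]
    group

theorem isChain_blocks {L : List (Perm (Fin (l + 4)))} (hc : L.IsChain IsPush)
    (hhead : L.head? = some 1) (hlast : L.getLast? = some (shortCycle l)⁻¹) (n : ℕ) :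
    (blocks L n).IsChain IsPush := by
  induction n with
  | zero => simp [blocks]
  | succ n ih =>
    rw [blocks_succ, block, List.isChain_append, List.isChain_append]
    refine ⟨ih, ⟨?_, by simp, ?_⟩, ?_⟩
    · rw [List.isChain_map]
      exact hc.imp fun x y h => h.mul_left _
    · intro x hx y hy
      rw [List.getLast?_map, hlast, Option.map_some, Option.mem_some_iff] at hx
      rw [List.head?_cons, Option.mem_some_iff] at hy
      subst hx hy
      exact isPush_fullCycle _
    · intro x hx y hy
      rw [List.head?_append, List.head?_map, hhead, Option.map_some, Option.some_or,
        Option.mem_some_iff, mul_one] at hy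
      rw [← hy, ← getLast?_blocks L n x hx]
      exact isPush_fullCycle x

/-- The permutations in a block are even and agree at the last index, except for the odd one. -/
theorem of_mem_block (hl : Even l) {L : List (Perm (Fin (l + 4)))}
    (hL : ∀ g ∈ L, g ∈ evenFixingLast l) {i : ℕ} {x : Perm (Fin (l + 4))}
    (hx : x ∈ block L (blockShift l ^ i)) :
    (Perm.sign x = 1 ∧ x (Fin.last (l + 3)) = (blockShift l ^ i) (Fin.last (l + 3)) ∧
      (blockShift l ^ i)⁻¹ * x ∈ L) ∨
    (Perm.sign x = -1 ∧ x = blockShift l ^ i * (shortCycle l)⁻¹ * fullCycle l) := by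
  have hs : Perm.sign (blockShift l ^ i) = 1 := by rw [map_pow, sign_blockShift hl, one_pow]
  rcases mem_block.1 hx with ⟨h, hh, rfl⟩ | rfl
  · left
    obtain ⟨h1, h2⟩ := mem_evenFixingLast.1 (hL h hh)
    refine ⟨by rw [Perm.sign_mul, hs, h1, one_mul], by rw [Perm.mul_apply, h2], ?_⟩
    rwa [inv_mul_cancel_left]
  · right
    refine ⟨?_, rfl⟩
    rw [Perm.sign_mul, Perm.sign_mul, Perm.sign_inv, hs, sign_shortCycle hl, sign_fullCycle hl]
    rfl

/-- Parity separates the odd codewords from the even ones; the last entries `blockShift ^ i (last)`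
are distinct and separate the blocks. -/
theorem nodup_blocks (hl : Even l) {L : List (Perm (Fin (l + 4)))} (hn : L.Nodup)
    (hL : ∀ g ∈ L, g ∈ evenFixingLast l) : (blocks L (l + 2)).Nodup := by
  rw [blocks, List.nodup_flatMap]
  refine ⟨fun i _ => ?_, ?_⟩
  · rw [block]
    refine List.nodup_append'.2 ⟨hn.map (mul_right_injective _), by simp, ?_⟩
    intro x hx hx'
    obtain ⟨h, hh, rfl⟩ := List.mem_map.1 hx
    rw [List.mem_singleton, mul_assoc] at hx'
    have h1 := (mem_evenFixingLast.1 (hL h hh)).1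
    rw [mul_left_cancel hx', Perm.sign_mul, Perm.sign_inv, sign_shortCycle hl,
      sign_fullCycle hl] at h1
    exact absurd h1 (by decide)
  · refine List.Pairwise.imp_of_mem ?_ (List.nodup_range (n := l + 2))
    intro i j hi hj hij x hxi hxj
    rw [List.mem_range] at hi hj
    apply hij
    rcases of_mem_block hl hL hxi with ⟨h1, h2, -⟩ | ⟨h1, h2⟩ <;>
      rcases of_mem_block hl hL hxj with ⟨h3, h4, -⟩ | ⟨h3, h4⟩
    · exact blockShift_pow_injOn hi hj (h2.symm.trans h4)
    · rw [h1] at h3; exact absurd h3 (by decide)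
    · rw [h1] at h3; exact absurd h3 (by decide)
    · rw [h2] at h4
      exact blockShift_pow_injOn hi hj (by rw [mul_right_cancel (mul_right_cancel h4)])

theorem sign_isAdjTransposition {n : ℕ} {s : Perm (Fin n)} (h : IsAdjTransposition s) :
    Perm.sign s = -1 := by
  obtain ⟨i, j, hij, rfl⟩ := h
  apply Perm.sign_swap
  rintro rfl
  omega

/-- An even and an odd permutation among the blocks do not differ by an adjacent transposition. -/
theorem blocks_ne_mul_adjTransposition_of_sign (hl : Even l) {L : List (Perm (Fin (l + 4)))}
    (hL : ∀ g ∈ L, g ∈ evenFixingLast l) (hmiss : (longCycle l)⁻¹ ∉ L)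
    {x y s : Perm (Fin (l + 4))} (hx : x ∈ blocks L (l + 2)) (hy : y ∈ blocks L (l + 2))
    (hsx : Perm.sign x = 1) (hs : IsAdjTransposition s) : x ≠ y * s := by
  intro hxy
  obtain ⟨i, hi, hx⟩ := mem_blocks.1 hx
  obtain ⟨j, hj, hy⟩ := mem_blocks.1 hy
  have hsy : Perm.sign y = -1 := by
    rw [hxy, Perm.sign_mul, sign_isAdjTransposition hs] at hsx
    rcases Int.units_eq_one_or (Perm.sign y) with h | h
    · rw [h] at hsx; exact absurd hsx (by decide)
    · exact h
  rcases of_mem_block hl hL hx with ⟨-, hxl, hxL⟩ | ⟨h, -⟩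
  swap
  · rw [hsx] at h; exact absurd h (by decide)
  rcases of_mem_block hl hL hy with ⟨h, -, -⟩ | ⟨-, hy⟩
  · rw [hsy] at h; exact absurd h (by decide)
  obtain ⟨p, q, hpq, rfl⟩ := hs
  by_cases hq : (q : ℕ) = l + 3
  -- Swapping the last two places leads to the missed element of the next block, with block indices
  -- read modulo `l + 2`.
  · have hp : p = ⟨l + 2, by omega⟩ := Fin.ext (by simp only; omega)
    have hq : q = ⟨l + 3, by omega⟩ := Fin.ext hq
    have hx' : x = blockShift l ^ (j + 1) * (longCycle l)⁻¹ := by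
      rw [hxy, hy, ← fullCycle_inv_mul_swap, hp, hq, pow_succ, blockShift]
      group
    have hlong : (longCycle l)⁻¹ (Fin.last (l + 3)) = Fin.last (l + 3) := by
      apply Fin.ext
      rw [val_longCycle_inv]
      simp
    have hmod : ∃ j' < l + 2, blockShift l ^ (j + 1) = blockShift l ^ j' := by
      by_cases h : j + 1 < l + 2
      · exact ⟨j + 1, h, rfl⟩
      · refine ⟨0, by omega, ?_⟩
        rw [show j + 1 = l + 2 by omega, blockShift_pow_eq_one hl, pow_zero]
    obtain ⟨j', hj', he⟩ := hmod
    rw [he] at hx'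
    rw [hx', Perm.mul_apply, hlong] at hxl
    have := blockShift_pow_injOn hj' hi hxl
    subst this
    rw [hx', inv_mul_cancel_left] at hxL
    exact hmiss hxL
  -- Any other swap keeps the last entry of `y`, which lies in the 2-cycle `{0, l + 2}` of
  -- `blockShift`; the last entries of even codewords lie in the other cycle.
  · have h1 : x (Fin.last (l + 3)) = (blockShift l ^ j) ⟨l + 2, by omega⟩ := by
      rw [hxy, hy, Perm.mul_apply, swap_apply_of_ne_of_ne, mul_assoc, Perm.mul_apply,
        Perm.mul_apply]
      · congr 1
        apply Fin.ext
        rw [val_shortCycle_inv, val_fullCycle]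
        simp
      · intro h
        have := congrArg Fin.val h
        have := q.2
        simp at *
        omega
      · intro h
        have := congrArg Fin.val h
        simp at this
        omega
    rw [hxl] at h1
    have := congrArg Fin.val h1
    rw [val_blockShift_pow_last hi, val_blockShift_pow_penultimate] at this
    split_ifs at this <;> omega

theorem isAdjTransposition_mul_self {n : ℕ} {s : Perm (Fin n)} (h : IsAdjTransposition s) :
    s * s = 1 := by
  obtain ⟨i, j, -, rfl⟩ := h
  exact swap_mul_self i j

theorem two_le_kendallTau {n : ℕ} {x y : Perm (Fin n)} (hxy : x ≠ y)
    (h : ∀ s, IsAdjTransposition s → x ≠ y * s) : 2 ≤ kendallTau x y := by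
  obtain ⟨L, hlen, hL, he⟩ := kendallTau_spec x y
  rw [← hlen]
  match L, hL, he with
  | [], _, he => exact absurd (by simpa using he) hxy
  | [s], hL, he => exact absurd (by simpa using he) (h s (hL s (by simp)))
  | _ :: _ :: _, _, _ => simp

theorem two_le_kendallTau_blocks (hl : Even l) {L : List (Perm (Fin (l + 4)))}
    (hL : ∀ g ∈ L, g ∈ evenFixingLast l) (hmiss : (longCycle l)⁻¹ ∉ L)
    {x y : Perm (Fin (l + 4))} (hx : x ∈ blocks L (l + 2)) (hy : y ∈ blocks L (l + 2))
    (hxy : x ≠ y) : 2 ≤ kendallTau x y := by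
  refine two_le_kendallTau hxy fun s hs h => ?_
  rcases Int.units_eq_one_or (Perm.sign x) with hsx | hsx
  · exact blocks_ne_mul_adjTransposition_of_sign hl hL hmiss hx hy hsx hs h
  · refine blocks_ne_mul_adjTransposition_of_sign hl hL hmiss hy hx ?_ hs ?_ (s := s)
    · rw [h, Perm.sign_mul, sign_isAdjTransposition hs] at hsx
      rcases Int.units_eq_one_or (Perm.sign y) with h' | h'
      · exact h'
      · rw [h'] at hsx; exact absurd hsx (by decide)
    · rw [h, mul_assoc, isAdjTransposition_mul_self hs, mul_one]

theorem isKendallSnake_get {n : ℕ} {C : List (Perm (Fin n))} (hn : C.Nodup)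
    (hc : C.IsChain IsPush) (hcyc : ∀ x ∈ C.getLast?, ∀ y ∈ C.head?, IsPush x y)
    (hd : ∀ x ∈ C, ∀ y ∈ C, x ≠ y → 2 ≤ kendallTau x y) :
    IsKendallSnake n C.length C.get := by
  refine ⟨⟨List.nodup_iff_injective_get.1 hn, fun r => ?_⟩, ?_⟩
  · have hpos : 0 < C.length := r.pos
    have : NeZero C.length := ⟨hpos.ne'⟩
    by_cases hr : (r : ℕ) + 1 < C.length
    · have hrot : finRotate C.length r = ⟨r + 1, hr⟩ := by
        obtain ⟨m, hm⟩ := Nat.exists_eq_succ_of_ne_zero hpos.ne'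
        generalize C.length = M at *
        subst hm
        apply Fin.ext
        rw [coe_finRotate_of_ne_last]
        intro h
        rw [h] at hr
        simp at hr
      rw [hrot]
      exact List.isChain_iff_getElem.1 hc r hr
    · have hrot : finRotate C.length r = ⟨0, hpos⟩ := by
        obtain ⟨m, hm⟩ := Nat.exists_eq_succ_of_ne_zero hpos.ne'
        generalize C.length = M at *
        subst hm
        have : r = Fin.last m := Fin.ext (by simp only [Fin.val_last]; omega)
        rw [this, finRotate_last]
        rfl
      rw [hrot]
      refine hcyc _ ?_ _ ?_
      · rw [List.getLast?_eq_getElem?, Option.mem_def, List.getElem?_eq_some_iff]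
        refine ⟨by omega, ?_⟩
        rw [List.get_eq_getElem]
        congr 1
        omega
      · rw [List.head?_eq_getElem?, Option.mem_def, List.getElem?_eq_some_iff]
        exact ⟨hpos, rfl⟩
  · rintro _ ⟨i, rfl⟩ _ ⟨j, rfl⟩ hij
    exact hd _ (List.get_mem _ _) _ (List.get_mem _ _) hij

/-- The construction of a snake of size `(l + 2) * ((l + 3)! / 2 - l)` for even `l ≥ 2`. -/
theorem exists_isKendallSnake (hl : Even l) (hl2 : 2 ≤ l) :
    ∃ K : ℕ, 2 * (K + l) = (l + 3).factorial ∧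
      ∃ c : Fin ((l + 2) * K) → Perm (Fin (l + 4)), IsKendallSnake (l + 4) ((l + 2) * K) c := by
  obtain ⟨L, hn, hc, hhead, hlast, hL, hmiss, hlen⟩ := exists_path hl hl2
  refine ⟨L.length + 1, by rw [← hlen]; ring, ?_⟩
  rw [← length_blocks]
  refine ⟨_, isKendallSnake_get (nodup_blocks hl hn hL) (isChain_blocks hc hhead hlast _) ?_
    fun x hx y hy hxy => two_le_kendallTau_blocks hl hL hmiss hx hy hxy⟩
  intro x hx y hy
  rw [head?_blocks hhead (by omega), Option.mem_some_iff] at hy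
  rw [← hy, ← blockShift_pow_eq_one hl, ← getLast?_blocks L _ x hx]
  exact isPush_fullCycle x

end Blocks

/-! ### Upper bound and asymptotics -/

theorem kendallTau_mul_adjTransposition_le {n : ℕ} {s : Equiv.Perm (Fin n)}
    (hs : IsAdjTransposition s) (x : Equiv.Perm (Fin n)) : kendallTau (x * s) x ≤ 1 :=
  Nat.sInf_le ⟨[s], rfl, by simpa using hs, by simp⟩

/-- A snake contains at most one element of each pair `{x, x ∘ (1, 2)}`. -/
theorem IsKendallSnake.two_mul_le {n N : ℕ} {c : Fin N → Equiv.Perm (Fin n)}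
    (h : IsKendallSnake n N c) : 2 * N ≤ n.factorial := by
  rcases Nat.eq_zero_or_pos N with rfl | hN
  · simp
  -- A nonempty snake has a transition with positive index, which forces `n ≥ 2`, so the places `0`
  -- and `1` exist.
  obtain ⟨j, hj, -⟩ := h.1.2 ⟨0, hN⟩
  have hs : IsAdjTransposition (Equiv.swap (⟨0, by omega⟩ : Fin n) ⟨1, by omega⟩) :=
    ⟨_, _, rfl, rfl⟩
  set s := Equiv.swap (⟨0, by omega⟩ : Fin n) ⟨1, by omega⟩
  have hs1 : s ≠ 1 := by
    intro h1
    have := sign_isAdjTransposition hs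
    rw [h1, Equiv.Perm.sign_one] at this
    exact absurd this (by decide)
  have hinj : Function.Injective
      (Sum.elim c fun i => c i * s : Fin N ⊕ Fin N → Equiv.Perm (Fin n)) := by
    refine h.1.1.sumElim ((mul_left_injective s).comp h.1.1) fun a b hab => ?_
    have h2 := h.2 (c a) ⟨a, rfl⟩ (c b) ⟨b, rfl⟩ (by
      rw [hab]
      intro h'
      exact hs1 (mul_eq_left.1 h'))
    rw [hab] at h2
    exact absurd (h2.trans (kendallTau_mul_adjTransposition_le hs (c b))) (by norm_num)
  have := Fintype.card_le_of_injective _ hinj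
  rw [Fintype.card_sum, Fintype.card_fin, Fintype.card_perm, Fintype.card_fin] at this
  omega

/-- Since `(2m + 2)! = (2m + 2)(2m + 1)(2m)!` and `(2m)! ≥ m + 1` for `m ≥ 1`, the quotient is at
most `1 / (m + 1)`. -/
theorem tendsto_mul_div_factorial :
    Tendsto (fun m : ℕ => (2 * m - 2 : ℝ) * (2 * m) / (Nat.factorial (2 * m + 2) : ℝ)) atTop
      (𝓝 0) := by
  refine tendsto_of_tendsto_of_tendsto_of_le_of_le' tendsto_const_nhds
    (tendsto_one_div_add_atTop_nhds_zero_nat (𝕜 := ℝ)) ?_ ?_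
  · filter_upwards [eventually_ge_atTop 1] with m hm
    have : (1 : ℝ) ≤ m := by exact_mod_cast hm
    have : (0 : ℝ) ≤ 2 * m - 2 := by linarith
    positivity
  · filter_upwards with m
    have h1 : ((2 * m + 1).factorial : ℝ) ≥ 2 * m + 1 := by
      exact_mod_cast Nat.self_le_factorial (2 * m + 1)
    have h2 : ((2 * m + 2).factorial : ℝ) = (2 * m + 2) * (2 * m + 1) * (2 * m).factorial := by
      rw [Nat.factorial_succ, Nat.factorial_succ]
      push_cast
      ring
    have h3 : ((2 * m).factorial : ℝ) ≥ m + 1 ∨ m = 0 := by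
      rcases Nat.eq_zero_or_pos m with h | h
      · exact .inr h
      · left
        have := Nat.self_le_factorial (2 * m)
        have : m + 1 ≤ (2 * m).factorial := by omega
        exact_mod_cast this
    rcases h3 with h3 | rfl
    · have hm : (0 : ℝ) ≤ m := Nat.cast_nonneg m
      rw [h2, div_le_div_iff₀ (by positivity) (by positivity), one_mul]
      calc (2 * m - 2 : ℝ) * (2 * m) * (m + 1)
          ≤ ((2 * m + 2) * (2 * m + 1)) * (m + 1) := by
            apply mul_le_mul_of_nonneg_right _ (by positivity)
            nlinarith
        _ ≤ _ := mul_le_mul_of_nonneg_left h3 (by positivity)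
    · simp

end RankModulation

theorem mainTheorem5 :
    ∃ M : ℕ → ℕ,
      (∀ m : ℕ, 2 ≤ m →
        (M m : ℝ) =
          (2 * m : ℝ) / (2 * m + 2) * ((Nat.factorial (2 * m + 2) : ℝ) / 2)
            - (2 * m - 2) * (2 * m) ∧
        ∃ c : Fin (M m) → Equiv.Perm (Fin (2 * m + 2)),
          RankModulation.IsKendallSnake (2 * m + 2) (M m) c) ∧
      Tendsto (fun m : ℕ => (M m : ℝ) / (Nat.card (Equiv.Perm (Fin (2 * m + 2))) : ℝ))
        atTop (𝓝 (1 / 2)) ∧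
      ∀ (n N : ℕ) (c : Fin N → Equiv.Perm (Fin n)),
        RankModulation.IsKendallSnake n N c →
          (N : ℝ) / (Nat.card (Equiv.Perm (Fin n)) : ℝ) ≤ 1 / 2 := by
  have hex : ∀ m : ℕ, ∃ M : ℕ, 2 ≤ m →
      (M : ℝ) = (2 * m : ℝ) / (2 * m + 2) * ((Nat.factorial (2 * m + 2) : ℝ) / 2)
            - (2 * m - 2) * (2 * m) ∧
        ∃ c : Fin M → Equiv.Perm (Fin (2 * m + 2)),
          RankModulation.IsKendallSnake (2 * m + 2) M c := by
    intro m
    by_cases hm : 2 ≤ m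
    · obtain ⟨m, rfl⟩ := Nat.exists_eq_add_of_le' hm
      -- After replacing `m` by `m + 2`, the parameter `l = 2m - 2` becomes `2 * m + 2`.
      obtain ⟨K, hK, hc⟩ := RankModulation.exists_isKendallSnake (l := 2 * m + 2)
        ⟨m + 1, by ring⟩ (by omega)
      refine ⟨(2 * m + 2 + 2) * K, fun _ => ⟨?_, ?_⟩⟩
      · have hK' : (2 : ℝ) * (K + (2 * m + 2)) = ((2 * m + 2 + 3).factorial : ℝ) := by
          exact_mod_cast hK
        have hf : ((2 * (m + 2) + 2).factorial : ℝ) =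
            (2 * m + 6) * ((2 * m + 2 + 3).factorial : ℝ) := by
          rw [show 2 * (m + 2) + 2 = 2 * m + 2 + 3 + 1 by ring, Nat.factorial_succ]
          push_cast
          ring
        have hpos : (2 * ((m : ℝ) + 2) + 2) ≠ 0 := by positivity
        rw [hf, ← hK']
        push_cast
        field_simp
        ring
      · rw [show 2 * (m + 2) + 2 = 2 * m + 2 + 4 by ring]
        exact hc
    -- The value for `m < 2` is arbitrary; the limit only sees `m ≥ 2`.
    · exact ⟨0, fun h => absurd h hm⟩
  choose M hM using hex
  refine ⟨M, hM, ?_, fun n N c hc => ?_⟩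
  -- The density equals `m / (2m + 2) = 1/2 - 1/2 · 1/(m + 1)` minus the correction term over `(2m +
  -- 2)!`.
  · have h1 : Tendsto (fun m : ℕ => (1 / 2 - 1 / 2 * (1 / ((m : ℝ) + 1)) -
        (2 * m - 2 : ℝ) * (2 * m) / (Nat.factorial (2 * m + 2) : ℝ))) atTop (𝓝 (1 / 2)) := by
      have := (((tendsto_one_div_add_atTop_nhds_zero_nat (𝕜 := ℝ)).const_mul
        (1 / 2)).const_sub (1 / 2)).sub RankModulation.tendsto_mul_div_factorial
      rwa [mul_zero, sub_zero, sub_zero] at this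
    refine h1.congr' ?_
    filter_upwards [eventually_ge_atTop 2] with m hm
    rw [(hM m hm).1, Nat.card_perm, Nat.card_fin]
    have hf : ((2 * m + 2).factorial : ℝ) ≠ 0 := by positivity
    have hm1 : (m : ℝ) + 1 ≠ 0 := by positivity
    have hm2 : 2 * (m : ℝ) + 2 ≠ 0 := by positivity
    field_simp
    ring
  · have h := hc.two_mul_le
    rw [Nat.card_perm, Nat.card_fin, div_le_iff₀ (by positivity)]
    have h' : (2 * N : ℝ) ≤ n.factorial := by exact_mod_cast h
    linarith
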